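/- Let $n\ge 1$, let $\Omega\subset\mathbb{R}^n$ be a bounded Lipschitz domain (a bounded, non-empty, connected open set which near each of its boundary points is, after a rigid motion, the strict supergraph of a Lipschitz function of $n-1$ variables), let $T>0$ and $n<p\le\infty$, and put $\Omega_T=\Omega\times(0,T)$. Then $$L^\infty(0,T;W^{1,p}(\Omega))\cap H^1(0,T;L^2(\Omega))\hookrightarrow C(\overline{\Omega_T}).$$ That is, there is an injective linear map $\iota$ from the intersection space to $C(\overline{\Omega_T})$ such that for every $z$ in the intersection space the continuous function $\iota z$ is a representative of $z$, i.e. $(\iota z)(x,t)=z(t)(x)$ for almost every $t\in(0,T)$ and almost every $x\in\Omega$; and there is a constant $C$, depending only on $n,\Omega,T,p$, with $$\max_{\overline{\Omega_T}}|\iota z|\le C\,\max\bigl\{\|z\|_{L^\infty(0,T;W^{1,p}(\Omega))},\ \|z\|_{H^1(0,T;L^2(\Omega))}\bigr\}\qquad\text{for all such } z.$$ Here $L^\infty(0,T;X)$ and $L^2(0,T;X)$ are Bochner spaces, and $H^1(0,T;X)$ is the space of functions in $L^2(0,T;X)$ whose weak time derivative lies in $L^2(0,T;X)$. -/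

import Mathlib

open MeasureTheory Set
open scoped ENNReal ContDiff

noncomputable section

/-- A bounded Lipschitz domain of `ℝⁿ`: a bounded, open, connected, non-empty set that, near each
of its boundary points and after a rigid motion, is the strict supergraph of a Lipschitz function
of `n - 1` variables.  The vertical direction is the unit vector `ν`; the hyperplane orthogonal
to `ν` carries the other `n - 1` variables. -/
structure IsBoundedLipschitzDomain {n : ℕ} (Ω : Set (EuclideanSpace ℝ (Fin n))) : Prop where
  isBounded : Bornology.IsBounded Ω
  isOpen : IsOpen Ω
  isConnected : IsConnected Ω
  lipschitz_boundary : ∀ x₀ ∈ frontier Ω, ∃ r : ℝ, 0 < r ∧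
    ∃ ν : EuclideanSpace ℝ (Fin n), ‖ν‖ = 1 ∧
    ∃ (K : NNReal) (γ : (ℝ ∙ ν)ᗮ → ℝ), LipschitzWith K γ ∧
      ∀ x ∈ Metric.ball x₀ r,
        (x ∈ Ω ↔ γ ((ℝ ∙ ν)ᗮ.orthogonalProjectionOnto x) < inner ℝ ν x)

/-- The space `L^q(Ω)` of real functions, with respect to Lebesgue measure on `Ω`. -/
abbrev LSpace {n : ℕ} (Ω : Set (EuclideanSpace ℝ (Fin n))) (q : ℝ≥0∞) : Type :=
  Lp ℝ q (volume.restrict Ω)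

/-- The space `L^q(Ω; ℝⁿ)`, where `ℝⁿ` carries the Euclidean norm. -/
abbrev LVecSpace {n : ℕ} (Ω : Set (EuclideanSpace ℝ (Fin n))) (q : ℝ≥0∞) : Type :=
  Lp (EuclideanSpace ℝ (Fin n)) q (volume.restrict Ω)

/-- `g` is the weak gradient of `u` on `Ω`: integration by parts holds against all smooth
functions with compact support in `Ω`. -/
def IsWeakGradient {n : ℕ} (Ω : Set (EuclideanSpace ℝ (Fin n)))
    (u : EuclideanSpace ℝ (Fin n) → ℝ)
    (g : EuclideanSpace ℝ (Fin n) → EuclideanSpace ℝ (Fin n)) : Prop :=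
  ∀ φ : EuclideanSpace ℝ (Fin n) → ℝ, ContDiff ℝ ∞ φ → HasCompactSupport φ → tsupport φ ⊆ Ω →
    ∀ i : Fin n, ∫ x in Ω, u x * fderiv ℝ φ x (EuclideanSpace.single i 1)
      = -∫ x in Ω, g x i * φ x

theorem integrable_mul_test {n : ℕ} {Ω : Set (EuclideanSpace ℝ (Fin n))}
    {f φ : EuclideanSpace ℝ (Fin n) → ℝ} {p : ℝ≥0∞} (hp : 1 ≤ p)
    (hf : MemLp f p (volume.restrict Ω)) (hφ : Continuous φ) (hc : HasCompactSupport φ) :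
    Integrable (fun x => f x * φ x) (volume.restrict Ω) := by
  have := (hf.locallyIntegrable hp).integrable_smul_left_of_hasCompactSupport hφ hc
  refine this.congr (Filter.Eventually.of_forall fun x => ?_)
  simp [mul_comm]

theorem integrable_mul_test_fderiv {n : ℕ} {Ω : Set (EuclideanSpace ℝ (Fin n))}
    {f φ : EuclideanSpace ℝ (Fin n) → ℝ} {p : ℝ≥0∞} (hp : 1 ≤ p)
    (hf : MemLp f p (volume.restrict Ω)) (hφ : ContDiff ℝ ∞ φ) (hc : HasCompactSupport φ)
    (e : EuclideanSpace ℝ (Fin n)) :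
    Integrable (fun x => f x * fderiv ℝ φ x e) (volume.restrict Ω) := by
  refine integrable_mul_test hp hf ?_ (hc.fderiv_apply (𝕜 := ℝ) e)
  exact (hφ.continuous_fderiv (by simp)).clm_apply continuous_const

theorem memLp_coord {n : ℕ} {Ω : Set (EuclideanSpace ℝ (Fin n))} {p : ℝ≥0∞}
    (g : LVecSpace Ω p) (i : Fin n) : MemLp (fun x => g x i) p (volume.restrict Ω) :=
  (EuclideanSpace.proj (𝕜 := ℝ) i).comp_memLp' (Lp.memLp g)

/-- The Sobolev space `W^{1,p}(Ω)`, as the space of pairs `(u, ∇u)` in `L^p(Ω) × L^p(Ω; ℝⁿ)`.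
For open `Ω` the second component is determined by the first.  The norm inherited from the
product is `max ‖u‖_p ‖∇u‖_p`, which is equivalent to the usual norm. -/
def W1p {n : ℕ} (Ω : Set (EuclideanSpace ℝ (Fin n))) (p : ℝ≥0∞) [Fact (1 ≤ p)] :
    Submodule ℝ (LSpace Ω p × LVecSpace Ω p) where
  carrier := {w | IsWeakGradient Ω w.1 w.2}
  zero_mem' := by
    intro φ _ _ _ i
    have h1 : ∫ x in Ω, ((0 : LSpace Ω p) : EuclideanSpace ℝ (Fin n) → ℝ) x *
        fderiv ℝ φ x (EuclideanSpace.single i 1) = ∫ x in Ω, (0 : ℝ) := by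
      refine integral_congr_ae ?_
      filter_upwards [Lp.coeFn_zero ℝ p (volume.restrict Ω)] with x hx
      rw [hx]; simp
    have h2 : ∫ x in Ω, ((0 : LVecSpace Ω p) : _ → EuclideanSpace ℝ (Fin n)) x i * φ x
        = ∫ x in Ω, (0 : ℝ) := by
      refine integral_congr_ae ?_
      filter_upwards [Lp.coeFn_zero (EuclideanSpace ℝ (Fin n)) p (volume.restrict Ω)] with x hx
      rw [hx]; simp
    exact h1.trans (by rw [show (0 : LSpace Ω p × LVecSpace Ω p).2 = 0 from rfl, h2]; simp)
  add_mem' := by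
    intro a b ha hb φ hφ hc hs i
    have hp : 1 ≤ p := Fact.out
    have h1 : ∫ x in Ω, (a.1 + b.1 : LSpace Ω p) x * fderiv ℝ φ x (EuclideanSpace.single i 1)
        = ∫ x in Ω, (a.1 x * fderiv ℝ φ x (EuclideanSpace.single i 1)
          + b.1 x * fderiv ℝ φ x (EuclideanSpace.single i 1)) := by
      refine integral_congr_ae ?_
      filter_upwards [Lp.coeFn_add a.1 b.1] with x hx
      rw [hx, Pi.add_apply, add_mul]
    have h2 : ∫ x in Ω, (a.2 + b.2 : LVecSpace Ω p) x i * φ x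
        = ∫ x in Ω, (a.2 x i * φ x + b.2 x i * φ x) := by
      refine integral_congr_ae ?_
      filter_upwards [Lp.coeFn_add a.2 b.2] with x hx
      rw [hx, Pi.add_apply, PiLp.add_apply, add_mul]
    rw [integral_add (integrable_mul_test_fderiv hp (Lp.memLp _) hφ hc _)
      (integrable_mul_test_fderiv hp (Lp.memLp _) hφ hc _)] at h1
    rw [integral_add (integrable_mul_test hp (memLp_coord _ _) hφ.continuous hc)
      (integrable_mul_test hp (memLp_coord _ _) hφ.continuous hc)] at h2
    refine h1.trans ?_
    rw [Prod.snd_add, h2, ha φ hφ hc hs i, hb φ hφ hc hs i, neg_add]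
  smul_mem' := by
    intro c a ha φ hφ hc hs i
    have h1 : ∫ x in Ω, (c • a.1 : LSpace Ω p) x * fderiv ℝ φ x (EuclideanSpace.single i 1)
        = ∫ x in Ω, c * (a.1 x * fderiv ℝ φ x (EuclideanSpace.single i 1)) := by
      refine integral_congr_ae ?_
      filter_upwards [Lp.coeFn_smul c a.1] with x hx
      rw [hx, Pi.smul_apply, smul_eq_mul, mul_assoc]
    have h2 : ∫ x in Ω, (c • a.2 : LVecSpace Ω p) x i * φ x
        = ∫ x in Ω, c * (a.2 x i * φ x) := by
      refine integral_congr_ae ?_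
      filter_upwards [Lp.coeFn_smul c a.2] with x hx
      rw [hx, Pi.smul_apply, PiLp.smul_apply, smul_eq_mul, mul_assoc]
    rw [integral_const_mul] at h1 h2
    refine h1.trans ?_
    rw [Prod.smul_snd, h2, ha φ hφ hc hs i, mul_neg]

/-- The `L^p` function underlying an element of `W^{1,p}(Ω)`, that is `(u, ∇u) ↦ u`. -/
def W1p.toLSpace {n : ℕ} {Ω : Set (EuclideanSpace ℝ (Fin n))} {p : ℝ≥0∞} [Fact (1 ≤ p)] :
    W1p Ω p →L[ℝ] LSpace Ω p :=
  (ContinuousLinearMap.fst ℝ (LSpace Ω p) (LVecSpace Ω p)).comp (W1p Ω p).subtypeL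

/-- `v'` is the weak derivative on `(0, T)` of the Banach space valued function `v`; the integrals
are Bochner integrals. -/
def IsWeakTimeDerivative {X : Type*} [NormedAddCommGroup X] [NormedSpace ℝ X] (T : ℝ)
    (v v' : ℝ → X) : Prop :=
  ∀ φ : ℝ → ℝ, ContDiff ℝ ∞ φ → HasCompactSupport φ → tsupport φ ⊆ Ioo 0 T →
    ∫ t in Ioo 0 T, deriv φ t • v t = -∫ t in Ioo 0 T, φ t • v' t

/-- The Bochner space `L^q(0, T; X)`. -/
abbrev BochnerSpace (T : ℝ) (X : Type*) [NormedAddCommGroup X] (q : ℝ≥0∞) :=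
  Lp X q (volume.restrict (Ioo 0 T))

theorem integrable_test_smul {X : Type*} [NormedAddCommGroup X] [NormedSpace ℝ X] {T : ℝ}
    (v : BochnerSpace T X 2) {φ : ℝ → ℝ} (hφ : Continuous φ) (hc : HasCompactSupport φ) :
    Integrable (fun t => φ t • v t) (volume.restrict (Ioo 0 T)) :=
  ((Lp.memLp v).locallyIntegrable (by norm_num)).integrable_smul_left_of_hasCompactSupport hφ hc

/-- The space `H^1(0, T; X)`, as the space of pairs `(v, ∂ₜv)` in `L^2(0, T; X) × L^2(0, T; X)`.
The second component is determined by the first.  The norm inherited from the product is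
equivalent to the usual norm. -/
def H1 (T : ℝ) (X : Type*) [NormedAddCommGroup X] [NormedSpace ℝ X] :
    Submodule ℝ (BochnerSpace T X 2 × BochnerSpace T X 2) where
  carrier := {w | IsWeakTimeDerivative T w.1 w.2}
  zero_mem' := by
    intro φ _ _ _
    have h (ψ : ℝ → ℝ) : ∫ t in Ioo 0 T, ψ t • ((0 : BochnerSpace T X 2) : ℝ → X) t = 0 := by
      refine (integral_congr_ae (g := fun _ => (0 : X)) ?_).trans (by simp)
      filter_upwards [Lp.coeFn_zero X 2 (volume.restrict (Ioo 0 T))] with x hx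
      rw [hx]; simp
    rw [Prod.fst_zero, Prod.snd_zero, h, h, neg_zero]
  add_mem' := by
    intro a b ha hb φ hφ hc hs
    have h (v w : BochnerSpace T X 2) (ψ : ℝ → ℝ) (h1 : Continuous ψ) (h2 : HasCompactSupport ψ) :
        ∫ t in Ioo 0 T, ψ t • (v + w : BochnerSpace T X 2) t
          = (∫ t in Ioo 0 T, ψ t • v t) + ∫ t in Ioo 0 T, ψ t • w t := by
      rw [← integral_add (integrable_test_smul v h1 h2) (integrable_test_smul w h1 h2)]
      refine integral_congr_ae ?_
      filter_upwards [Lp.coeFn_add v w] with x hx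
      rw [hx, Pi.add_apply, smul_add]
    rw [Prod.fst_add, Prod.snd_add, h _ _ _ (hφ.continuous_deriv (by simp)) hc.deriv,
      h _ _ _ hφ.continuous hc, ha φ hφ hc hs, hb φ hφ hc hs, neg_add]
  smul_mem' := by
    intro c a ha φ hφ hc hs
    have h (v : BochnerSpace T X 2) (ψ : ℝ → ℝ) :
        ∫ t in Ioo 0 T, ψ t • (c • v : BochnerSpace T X 2) t
          = c • ∫ t in Ioo 0 T, ψ t • v t := by
      rw [← integral_smul]
      refine integral_congr_ae ?_
      filter_upwards [Lp.coeFn_smul c v] with x hx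
      rw [hx, Pi.smul_apply, smul_comm]
    rw [Prod.smul_fst, Prod.smul_snd, h, h, ha φ hφ hc hs, smul_neg]

/-- The `L^2(0, T; X)` function underlying an element of `H^1(0, T; X)`, that is `(v, ∂ₜv) ↦ v`. -/
def H1.toBochner {T : ℝ} {X : Type*} [NormedAddCommGroup X] [NormedSpace ℝ X] :
    H1 T X →L[ℝ] BochnerSpace T X 2 :=
  (ContinuousLinearMap.fst ℝ (BochnerSpace T X 2) (BochnerSpace T X 2)).comp (H1 T X).subtypeL

/-- `u` and `v` are the same function on `Ω × (0, T)`: they agree almost everywhere in `Ω` at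
almost every time `t ∈ (0, T)`. -/
def AgreeAE {n : ℕ} {Ω : Set (EuclideanSpace ℝ (Fin n))} {T : ℝ} {p : ℝ≥0∞} [Fact (1 ≤ p)]
    (u : BochnerSpace T (W1p Ω p) ∞) (v : BochnerSpace T (LSpace Ω 2) 2) : Prop :=
  ∀ᵐ t ∂(volume.restrict (Ioo 0 T)), W1p.toLSpace (u t) =ᵐ[volume.restrict Ω] v t

theorem AgreeAE.zero {n : ℕ} {Ω : Set (EuclideanSpace ℝ (Fin n))} {T : ℝ} {p : ℝ≥0∞}
    [Fact (1 ≤ p)] :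
    AgreeAE (0 : BochnerSpace T (W1p Ω p) ∞) (0 : BochnerSpace T (LSpace Ω 2) 2) := by
  have h1 := Lp.coeFn_zero (W1p Ω p) ∞ (volume.restrict (Ioo 0 T))
  have h2 := Lp.coeFn_zero (LSpace Ω 2) 2 (volume.restrict (Ioo 0 T))
  filter_upwards [h1, h2] with t h1 h2
  rw [h1, h2, Pi.zero_apply, Pi.zero_apply, map_zero]
  exact (Lp.coeFn_zero ℝ p _).trans (Lp.coeFn_zero ℝ 2 _).symm

theorem AgreeAE.add {n : ℕ} {Ω : Set (EuclideanSpace ℝ (Fin n))} {T : ℝ} {p : ℝ≥0∞}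
    [Fact (1 ≤ p)] {u₁ u₂ : BochnerSpace T (W1p Ω p) ∞} {v₁ v₂ : BochnerSpace T (LSpace Ω 2) 2}
    (h₁ : AgreeAE u₁ v₁) (h₂ : AgreeAE u₂ v₂) : AgreeAE (u₁ + u₂) (v₁ + v₂) := by
  have e1 := Lp.coeFn_add u₁ u₂
  have e2 := Lp.coeFn_add v₁ v₂
  filter_upwards [h₁, h₂, e1, e2] with t h₁ h₂ e1 e2
  rw [e1, e2, Pi.add_apply, Pi.add_apply, map_add]
  exact (Lp.coeFn_add _ _).trans ((h₁.add h₂).trans (Lp.coeFn_add _ _).symm)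

theorem AgreeAE.smul {n : ℕ} {Ω : Set (EuclideanSpace ℝ (Fin n))} {T : ℝ} {p : ℝ≥0∞}
    [Fact (1 ≤ p)] (c : ℝ) {u : BochnerSpace T (W1p Ω p) ∞} {v : BochnerSpace T (LSpace Ω 2) 2}
    (h : AgreeAE u v) : AgreeAE (c • u) (c • v) := by
  have e1 := Lp.coeFn_smul c u
  have e2 := Lp.coeFn_smul c v
  filter_upwards [h, e1, e2] with t h e1 e2
  rw [e1, e2, Pi.smul_apply, Pi.smul_apply, map_smul]
  exact (Lp.coeFn_smul _ _).trans ((h.const_smul c).trans (Lp.coeFn_smul _ _).symm)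

/-- The intersection `L^∞(0, T; W^{1,p}(Ω)) ∩ H^1(0, T; L^2(Ω))`, as the space of pairs of an
element of either space that are the same function.  The norm inherited from the product is the
maximum of the two norms, the usual norm of an intersection. -/
def LinftyW1pInterH1L2 {n : ℕ} (Ω : Set (EuclideanSpace ℝ (Fin n))) (T : ℝ) (p : ℝ≥0∞)
    [Fact (1 ≤ p)] : Submodule ℝ (BochnerSpace T (W1p Ω p) ∞ × H1 T (LSpace Ω 2)) where
  carrier := {z | AgreeAE z.1 (H1.toBochner z.2)}
  zero_mem' := by
    change AgreeAE 0 (H1.toBochner 0)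
    rw [map_zero]
    exact AgreeAE.zero
  add_mem' := by
    intro a b ha hb
    change AgreeAE (a.1 + b.1) (H1.toBochner (a.2 + b.2))
    rw [map_add]
    exact AgreeAE.add ha hb
  smul_mem' := by
    intro c a ha
    change AgreeAE (c • a.1) (H1.toBochner (c • a.2))
    rw [map_smul]
    exact AgreeAE.smul c ha

/-- The value `z(t)`, as a function of `x ∈ Ω`, of an element `z` of the intersection space (a
representative of a class modulo null sets of times, and of points at each time). -/
def LinftyW1pInterH1L2.eval {n : ℕ} {Ω : Set (EuclideanSpace ℝ (Fin n))} {T : ℝ} {p : ℝ≥0∞}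
    [Fact (1 ≤ p)] (z : LinftyW1pInterH1L2 Ω T p) (t : ℝ) : EuclideanSpace ℝ (Fin n) → ℝ :=
  W1p.toLSpace (z.1.1 t)

end

/-! The weak time derivative makes z a continuous curve in L²(Ω); the W^{1,p} bound with p > n
controls point values by local means, uniformly in time (Morrey). Together they give joint
continuity.

Near a point of the closure there are ν, ρ and r₀ such that Ω contains, with each of its points x,
the balls of centre x + rν and radius rρ for 0 < r ≤ r₀ (`IsBoundedLipschitzDomain.exists_cone`).
Let A_r(x,t) be the mean of z(t) against a bump of mass one carried by such a ball. For fixed r it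
is jointly continuous (`continuous_kernelMean`). The r-derivative of the kernel is minus a
divergence in the integration variable, so ∂A_r/∂r is a mean of ∇z(t) (`hasDerivAt_kernelMean`),
which Hölder bounds by a multiple of ‖∇z(t)‖_p r^{-n/p}. This is integrable at 0 because p > n,
whence |A_r - A_s| ≤ C N r^{1-n/p} for s ≤ r, where N bounds the W^{1,p} norms
(`exists_abs_kernelMean_sub_le`). The estimate holds at almost every time and, by continuity of both
means, at every time and up to the boundary. Hence A_r converges uniformly to a continuous function
as r → 0, and Lebesgue differentiation identifies the limit with z (`ae_tendsto_kernelMean`).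

A partition of unity glues the local limits. Continuous representatives are unique, so passing to
them is linear; it is injective because a function determines its weak derivatives. -/

/-! ### Continuity in time from a weak time derivative -/

/-- Fubini on the triangle s < t: the integral of φ' over (s, T) is -φ(s), as φ(T) = 0. Thus a
primitive has the expected weak derivative. -/
theorem integral_deriv_smul_primitive {X : Type*} [NormedAddCommGroup X] [NormedSpace ℝ X]
    [CompleteSpace X] {T : ℝ} {g : ℝ → X}
    (hg : IntegrableOn g (Ioo 0 T)) {φ : ℝ → ℝ} (hφ : ContDiff ℝ ∞ φ) (hφc : HasCompactSupport φ)
    (hφT : φ T = 0) :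
    ∫ t in Ioo 0 T, deriv φ t • ∫ s in Ioo 0 t, g s = -∫ t in Ioo 0 T, φ t • g t := by
  have hdc : Continuous (deriv φ) := hφ.continuous_deriv (by simp)
  have hdi : IntegrableOn (deriv φ) (Ioo 0 T) :=
    (hdc.integrable_of_hasCompactSupport hφc.deriv).integrableOn
  have hm : MeasurableSet {q : ℝ × ℝ | q.2 < q.1} := measurableSet_lt measurable_snd measurable_fst
  have hint : Integrable (Function.uncurry fun t s : ℝ =>
      {q : ℝ × ℝ | q.2 < q.1}.indicator (fun q => deriv φ q.1 • g q.2) (t, s))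
      ((volume.restrict (Ioo 0 T)).prod (volume.restrict (Ioo 0 T))) :=
    (Integrable.smul_prod hdi hg).indicator hm
  have hswap := integral_integral_swap hint
  have hl : ∀ t ∈ Ioo 0 T, (∫ s in Ioo 0 T,
      {q : ℝ × ℝ | q.2 < q.1}.indicator (fun q => deriv φ q.1 • g q.2) (t, s))
      = deriv φ t • ∫ s in Ioo 0 t, g s := by
    intro t ht
    rw [← integral_smul]
    have h1 : (fun s => {q : ℝ × ℝ | q.2 < q.1}.indicator (fun q => deriv φ q.1 • g q.2) (t, s))
        = (Iio t).indicator fun s => deriv φ t • g s := by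
      ext s; simp [indicator]
    rw [h1, setIntegral_indicator measurableSet_Iio]
    congr 2
    ext s; simp only [mem_inter_iff, mem_Ioo, mem_Iio]
    exact ⟨fun h => ⟨h.1.1, h.2⟩, fun h => ⟨⟨h.1, h.2.trans ht.2⟩, h.2⟩⟩
  have hr : ∀ s ∈ Ioo 0 T, (∫ t in Ioo 0 T,
      {q : ℝ × ℝ | q.2 < q.1}.indicator (fun q => deriv φ q.1 • g q.2) (t, s))
      = -(φ s • g s) := by
    intro s hs
    have h1 : (fun t => {q : ℝ × ℝ | q.2 < q.1}.indicator (fun q => deriv φ q.1 • g q.2) (t, s))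
        = (Ioi s).indicator fun t => deriv φ t • g s := by
      ext t; simp [indicator]
    have h2 : Ioo 0 T ∩ Ioi s = Ioo s T := by
      ext t; simp only [mem_inter_iff, mem_Ioo, mem_Ioi]
      exact ⟨fun h => ⟨h.2, h.1.2⟩, fun h => ⟨⟨hs.1.trans h.1, h.2⟩, h.1⟩⟩
    rw [h1, setIntegral_indicator measurableSet_Ioi, h2, integral_smul_const,
      ← integral_Ioc_eq_integral_Ioo, ← intervalIntegral.integral_of_le hs.2.le,
      intervalIntegral.integral_deriv_eq_sub (fun x _ => (hφ.differentiable (by simp)) x)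
        (hdc.intervalIntegrable _ _), hφT, zero_sub, neg_smul]
  rw [setIntegral_congr_fun measurableSet_Ioo hl, setIntegral_congr_fun measurableSet_Ioo hr,
    integral_neg] at hswap
  exact hswap

/-- The lemma of du Bois-Reymond. -/
theorem ae_eq_const_of_integral_deriv_smul_eq_zero {X : Type*} [NormedAddCommGroup X]
    [NormedSpace ℝ X] [CompleteSpace X] {T : ℝ} (hT : 0 < T) {w : ℝ → X}
    (hw : IntegrableOn w (Ioo 0 T))
    (h : ∀ φ : ℝ → ℝ, ContDiff ℝ ∞ φ → HasCompactSupport φ → tsupport φ ⊆ Ioo 0 T →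
      ∫ t in Ioo 0 T, deriv φ t • w t = 0) :
    ∃ c : X, ∀ᵐ t ∂(volume.restrict (Ioo 0 T)), w t = c := by
  -- A test function η of mass one inside (0, T). The constant has to be the η-weighted mean of w.
  let b : ContDiffBump (T / 2) := ⟨T / 8, T / 4, by positivity, by linarith⟩
  set η : ℝ → ℝ := b.normed volume with hη
  have hηd : ContDiff ℝ ∞ η := b.contDiff_normed
  have hηc : HasCompactSupport η := b.hasCompactSupport_normed
  have hηs : tsupport η ⊆ Icc (T / 4) (3 * T / 4) := by
    rw [hη, b.tsupport_normed_eq, Real.closedBall_eq_Icc]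
    exact Icc_subset_Icc (by change _ ≤ T / 2 - T / 4; linarith)
      (by change T / 2 + T / 4 ≤ _; linarith)
  have hη1 : ∫ t, η t = 1 := b.integral_normed
  have hsm : ∀ {ψ : ℝ → ℝ}, Continuous ψ → HasCompactSupport ψ →
      Integrable (fun t => ψ t • w t) (volume.restrict (Ioo 0 T)) := fun hψ hc =>
    hw.integrable.locallyIntegrable.integrable_smul_left_of_hasCompactSupport hψ hc
  refine ⟨∫ t in Ioo 0 T, η t • w t, ?_⟩
  set c := ∫ t in Ioo 0 T, η t • w t with hc
  have hcint : IntegrableOn (fun _ : ℝ => c) (Ioo 0 T) := integrableOn_const (by simp)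
  have key := isOpen_Ioo.ae_eq_zero_of_integral_contDiff_smul_eq_zero (μ := volume)
    (U := Ioo 0 T) (f := fun t => w t - c) (hw.sub hcint).locallyIntegrableOn ?_
  · rw [ae_restrict_iff' measurableSet_Ioo]
    filter_upwards [key] with t ht h1 using sub_eq_zero.1 (ht h1)
  intro ψ hψ hψc hψs
  -- Subtracting m η leaves a function θ of integral zero, whose primitive Φ is an admissible test
  -- function. Testing with Φ turns ∫ ψ w into m c.
  set m := ∫ t, ψ t with hm
  set θ : ℝ → ℝ := fun t => ψ t - m * η t with hθ
  have hθd : ContDiff ℝ ∞ θ := hψ.sub (contDiff_const.mul hηd)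
  have hη0 : ∀ t, t ∉ Icc (T / 4) (3 * T / 4) → η t = 0 := fun t ht =>
    image_eq_zero_of_notMem_tsupport fun h => ht (hηs h)
  -- A compact interval, not just a compact set, is needed: Φ vanishes to its left trivially and to
  -- its right because θ has integral zero, but need not vanish in gaps of the support of θ.
  obtain ⟨a, b', ha, hb, hsupp⟩ : ∃ a b', 0 < a ∧ b' < T ∧
      ∀ t, t ∉ Icc a b' → θ t = 0 := by
    have hK : IsCompact (tsupport ψ) := hψc
    have hex : ∃ a b', 0 < a ∧ b' < T ∧ tsupport ψ ⊆ Icc a b' := by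
      rcases (tsupport ψ).eq_empty_or_nonempty with he | hne
      · exact ⟨T / 2, T / 2, by positivity, by linarith, by simp [he]⟩
      · obtain ⟨a, ha⟩ := hK.exists_isLeast hne
        obtain ⟨b', hb⟩ := hK.exists_isGreatest hne
        exact ⟨a, b', (hψs ha.1).1, (hψs hb.1).2, fun t ht => ⟨ha.2 ht, hb.2 ht⟩⟩
    obtain ⟨a, b', ha, hb, hs⟩ := hex
    refine ⟨min a (T / 4), max b' (3 * T / 4), lt_min ha (by positivity), max_lt hb (by linarith), ?_⟩
    intro t ht
    have h1 : ψ t = 0 := image_eq_zero_of_notMem_tsupport fun h => ht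
      ⟨(min_le_left _ _).trans (hs h).1, (hs h).2.trans (le_max_left _ _)⟩
    have h2 : η t = 0 := hη0 t fun h => ht
      ⟨(min_le_right _ _).trans h.1, h.2.trans (le_max_right _ _)⟩
    simp [hθ, h1, h2]
  have hψi : Integrable ψ := hψ.continuous.integrable_of_hasCompactSupport hψc
  have hηi : Integrable η := hηd.continuous.integrable_of_hasCompactSupport hηc
  have hθ0 : ∫ t, θ t = 0 := by
    rw [hθ, integral_sub hψi (hηi.const_mul m), integral_const_mul, hη1, mul_one, sub_self]
  set Φ : ℝ → ℝ := fun t => ∫ s in (0 : ℝ)..t, θ s with hΦ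
  have hΦd : ∀ t, HasDerivAt Φ (θ t) t := fun t =>
    intervalIntegral.integral_hasDerivAt_right (hθd.continuous.intervalIntegrable _ _)
      (hθd.continuous.stronglyMeasurableAtFilter _ _) hθd.continuous.continuousAt
  have hΦ' : deriv Φ = θ := funext fun t => (hΦd t).deriv
  have hΦs : ContDiff ℝ ∞ Φ :=
    contDiff_infty_iff_deriv.2 ⟨fun t => (hΦd t).differentiableAt, hΦ' ▸ hθd⟩
  have hΦ0 : ∀ t, t ∉ Icc a b' → Φ t = 0 := by
    intro t ht
    rcases lt_or_ge t a with h1 | h1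
    · rw [hΦ]
      refine (intervalIntegral.integral_congr (g := fun _ => (0 : ℝ)) fun s hs => ?_).trans (by simp)
      refine hsupp s fun h => ?_
      rcases mem_uIcc.1 hs with h2 | h2
      · linarith [h.1, h2.2]
      · linarith [h.1, h2.2]
    · have h2 : b' < t := by
        by_contra h3; exact ht ⟨h1, not_lt.1 h3⟩
      rw [← hθ0]
      refine intervalIntegral.integral_eq_integral_of_support_subset fun s hs => ?_
      by_contra h3
      refine hs (hsupp s fun h => h3 ⟨ha.trans_le h.1, h.2.trans h2.le⟩)
  have hΦt : tsupport Φ ⊆ Icc a b' :=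
    closure_minimal (fun t ht => by_contra fun h => ht (hΦ0 t h)) isClosed_Icc
  have h0 := h Φ hΦs (HasCompactSupport.of_support_subset_isCompact isCompact_Icc
    (subset_closure.trans hΦt)) (hΦt.trans fun t ht => ⟨ha.trans_le ht.1, ht.2.trans_lt hb⟩)
  rw [hΦ'] at h0
  have h1 : ∫ t in Ioo 0 T, ψ t • w t = m • c := by
    have h2 : ∀ t, θ t • w t = ψ t • w t - m • (η t • w t) := fun t => by
      rw [hθ]; simp only [sub_smul, mul_smul]
    simp_rw [h2] at h0
    rw [integral_sub (hsm hψ.continuous hψc) (show Integrable (fun t => m • (η t • w t)) _ from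
      (hsm hηd.continuous hηc).smul m), integral_smul] at h0
    exact sub_eq_zero.1 h0
  have h3 : ∫ t in Ioo 0 T, ψ t = m :=
    setIntegral_eq_integral_of_forall_compl_eq_zero fun t ht =>
      image_eq_zero_of_notMem_tsupport fun h => ht (hψs h)
  have h4 : ∫ t in Ioo 0 T, ψ t • (w t - c) = 0 := by
    simp_rw [smul_sub]
    rw [integral_sub (hsm hψ.continuous hψc) (hψi.integrableOn.smul_const c), h1,
      integral_smul_const, h3, sub_self]
  rw [← h4]
  exact (setIntegral_eq_integral_of_forall_compl_eq_zero fun t ht => by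
    rw [image_eq_zero_of_notMem_tsupport fun h => ht (hψs h), zero_smul]).symm

/-- A function with an integrable weak derivative has a continuous representative. -/
theorem IsWeakTimeDerivative.exists_continuous {X : Type*} [NormedAddCommGroup X]
    [NormedSpace ℝ X] [CompleteSpace X] {T : ℝ} (hT : 0 < T) {v v' : ℝ → X}
    (hv : IntegrableOn v (Ioo 0 T)) (hv' : IntegrableOn v' (Ioo 0 T))
    (h : IsWeakTimeDerivative T v v') :
    ∃ V : ℝ → X, Continuous V ∧ ∀ᵐ t ∂(volume.restrict (Ioo 0 T)), V t = v t := by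
  -- Extending v' by zero makes the primitive continuous on all of ℝ, hence up to the end points 0
  -- and T.
  set W : ℝ → X := fun t => ∫ s in (0 : ℝ)..t, (Ioo 0 T).indicator v' s with hW
  have hi : Integrable ((Ioo 0 T).indicator v') := hv'.integrable_indicator measurableSet_Ioo
  have hWc : Continuous W := intervalIntegral.continuous_primitive
    (fun a b => hi.intervalIntegrable) 0
  have hWe : ∀ t ∈ Ioo 0 T, W t = ∫ s in Ioo 0 t, v' s := by
    intro t ht
    rw [hW]
    simp only
    rw [intervalIntegral.integral_of_le ht.1.le, integral_Ioc_eq_integral_Ioo]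
    refine setIntegral_congr_fun measurableSet_Ioo fun s hs => ?_
    exact indicator_of_mem (show s ∈ Ioo 0 T from ⟨hs.1, hs.2.trans ht.2⟩) _
  have hWi : IntegrableOn W (Ioo 0 T) :=
    (hWc.integrableOn_Icc (a := 0) (b := T)).mono_set Ioo_subset_Icc_self
  -- v - W has weak derivative zero.
  obtain ⟨c, hc⟩ := ae_eq_const_of_integral_deriv_smul_eq_zero hT (w := fun t => v t - W t)
    (hv.sub hWi) (by
      intro φ hφ hφc hs
      have hdc : Continuous (deriv φ) := hφ.continuous_deriv (by simp)
      have hsm : ∀ {w : ℝ → X}, IntegrableOn w (Ioo 0 T) →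
          Integrable (fun t => deriv φ t • w t) (volume.restrict (Ioo 0 T)) := fun hw =>
        hw.integrable.locallyIntegrable.integrable_smul_left_of_hasCompactSupport hdc hφc.deriv
      simp_rw [smul_sub]
      rw [integral_sub (hsm hv) (hsm hWi), h φ hφ hφc hs,
        ← integral_deriv_smul_primitive hv' hφ hφc
          (image_eq_zero_of_notMem_tsupport fun h => (lt_irrefl _ (hs h).2)), sub_eq_zero]
      exact setIntegral_congr_fun measurableSet_Ioo fun t ht => by simp only [hWe t ht])
  refine ⟨fun t => W t + c, hWc.add continuous_const, ?_⟩
  filter_upwards [hc] with t ht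
  rw [← ht]; abel

/-! ### Rescaled kernels -/

/-- The rescaled kernel `w ↦ r⁻ⁿ φ((w - x) / r)`. -/
noncomputable def scaledKernel {n : ℕ} (φ : EuclideanSpace ℝ (Fin n) → ℝ) (r : ℝ)
    (x w : EuclideanSpace ℝ (Fin n)) : ℝ :=
  (r ^ n)⁻¹ * φ (r⁻¹ • (w - x))

/-- The mean of `u` over `Ω`, weighted by the kernel `φ` at scale `r` around `x`. -/
noncomputable def kernelMean {n : ℕ} (Ω : Set (EuclideanSpace ℝ (Fin n)))
    (φ : EuclideanSpace ℝ (Fin n) → ℝ) (u : EuclideanSpace ℝ (Fin n) → ℝ) (r : ℝ)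
    (x : EuclideanSpace ℝ (Fin n)) : ℝ :=
  ∫ w in Ω, scaledKernel φ r x w * u w

section Kernel

variable {n : ℕ} {φ : EuclideanSpace ℝ (Fin n) → ℝ}

theorem contDiff_scaledKernel (hφ : ContDiff ℝ ∞ φ) (r : ℝ) (x : EuclideanSpace ℝ (Fin n)) :
    ContDiff ℝ ∞ (scaledKernel φ r x) :=
  contDiff_const.mul (hφ.comp ((contDiff_id.sub contDiff_const).const_smul r⁻¹))

/-- As r varies, these balls sweep out the cone with vertex x that the geometry of Ω provides. -/
theorem scaledKernel_eq_zero {ν : EuclideanSpace ℝ (Fin n)} {ρ : ℝ}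
    (hs : ∀ v, v ∉ Metric.closedBall ν ρ → φ v = 0) {r : ℝ} (hr : 0 < r)
    {x w : EuclideanSpace ℝ (Fin n)} (hw : w ∉ Metric.closedBall (x + r • ν) (r * ρ)) :
    scaledKernel φ r x w = 0 := by
  rw [scaledKernel, hs, mul_zero]
  intro h
  apply hw
  rw [Metric.mem_closedBall, dist_eq_norm] at h ⊢
  have : w - (x + r • ν) = r • (r⁻¹ • (w - x) - ν) := by
    rw [smul_sub, smul_smul, mul_inv_cancel₀ hr.ne', one_smul]; abel
  rw [this, norm_smul, Real.norm_of_nonneg hr.le]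
  gcongr

theorem tsupport_scaledKernel_subset {ν : EuclideanSpace ℝ (Fin n)} {ρ : ℝ}
    (hs : ∀ v, v ∉ Metric.closedBall ν ρ → φ v = 0) {r : ℝ} (hr : 0 < r)
    (x : EuclideanSpace ℝ (Fin n)) :
    tsupport (scaledKernel φ r x) ⊆ Metric.closedBall (x + r • ν) (r * ρ) :=
  closure_minimal (fun _ hw => by_contra fun h => hw (scaledKernel_eq_zero hs hr h))
    Metric.isClosed_closedBall

theorem hasCompactSupport_scaledKernel {ν : EuclideanSpace ℝ (Fin n)} {ρ : ℝ}
    (hs : ∀ v, v ∉ Metric.closedBall ν ρ → φ v = 0) {r : ℝ} (hr : 0 < r)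
    (x : EuclideanSpace ℝ (Fin n)) : HasCompactSupport (scaledKernel φ r x) :=
  (isCompact_closedBall _ _).of_isClosed_subset (isClosed_tsupport _)
    (tsupport_scaledKernel_subset hs hr x)

theorem abs_scaledKernel_le {M : ℝ} (hM : ∀ v, |φ v| ≤ M) {r : ℝ} (hr : 0 < r)
    (x w : EuclideanSpace ℝ (Fin n)) : |scaledKernel φ r x w| ≤ (r ^ n)⁻¹ * M := by
  rw [scaledKernel, abs_mul, abs_of_pos (by positivity)]
  gcongr
  exact hM _

theorem hasDerivAt_scaledKernel (hφ : Differentiable ℝ φ) {r : ℝ} (hr : r ≠ 0)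
    (x w : EuclideanSpace ℝ (Fin n)) :
    HasDerivAt (fun r => scaledKernel φ r x w)
      (-((r ^ (n + 1))⁻¹ * (n * φ (r⁻¹ • (w - x))
        + fderiv ℝ φ (r⁻¹ • (w - x)) (r⁻¹ • (w - x))))) r := by
  have h1 : HasDerivAt (fun r : ℝ => (r ^ n)⁻¹) (-(n * r ^ (n - 1)) / (r ^ n) ^ 2) r :=
    (hasDerivAt_pow n r).inv (pow_ne_zero _ hr)
  have h2 : HasDerivAt (fun r : ℝ => r⁻¹ • (w - x)) ((-(r ^ 2)⁻¹) • (w - x)) r :=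
    (hasDerivAt_inv hr).smul_const _
  have h3 := (hφ (r⁻¹ • (w - x))).hasFDerivAt.comp_hasDerivAt r h2
  refine (h1.mul h3).congr_deriv ?_
  simp only [Function.comp_apply, map_smul, smul_eq_mul]
  -- For n = 0 the exponent n - 1 is truncated, so the powers of r are simplified separately.
  rcases n with _ | k
  · simp only [pow_zero, Nat.cast_zero]
    field_simp
    ring
  · simp only [Nat.add_sub_cancel, Nat.cast_add, Nat.cast_one]
    field_simp
    ring

theorem fderiv_scaledKernel (hφ : Differentiable ℝ φ) (r : ℝ)
    (x w e : EuclideanSpace ℝ (Fin n)) :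
    fderiv ℝ (scaledKernel φ r x) w e
      = (r ^ n)⁻¹ * (r⁻¹ * fderiv ℝ φ (r⁻¹ • (w - x)) e) := by
  have h2 : HasFDerivAt (fun w : EuclideanSpace ℝ (Fin n) => r⁻¹ • (w - x))
      (r⁻¹ • ContinuousLinearMap.id ℝ _) w := ((hasFDerivAt_id w).sub_const x).const_smul r⁻¹
  have h3 := ((hφ (r⁻¹ • (w - x))).hasFDerivAt.comp w h2).const_mul (r ^ n)⁻¹
  have h4 : HasFDerivAt (scaledKernel φ r x) _ w := h3
  rw [h4.fderiv]
  simp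

theorem sum_fderiv_mul_coord (hφ : Differentiable ℝ φ) (y : EuclideanSpace ℝ (Fin n)) :
    ∑ i, fderiv ℝ (fun v => φ v * v i) y (EuclideanSpace.single i 1)
      = n * φ y + fderiv ℝ φ y y := by
  have h : ∀ i, fderiv ℝ (fun v => φ v * v i) y (EuclideanSpace.single i 1)
      = φ y + y i * fderiv ℝ φ y (EuclideanSpace.single i 1) := by
    intro i
    have h1 : HasFDerivAt (fun v : EuclideanSpace ℝ (Fin n) => v i)
        (EuclideanSpace.proj (𝕜 := ℝ) i) y :=
      (EuclideanSpace.proj (𝕜 := ℝ) i : EuclideanSpace ℝ (Fin n) →L[ℝ] ℝ).hasFDerivAt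
    have h2 : HasFDerivAt (fun v => φ v * v i) _ y := (hφ y).hasFDerivAt.mul h1
    rw [h2.fderiv]
    simp
  have hy : y = ∑ i, y i • EuclideanSpace.single i (1 : ℝ) := by
    ext j
    simp [Finset.sum_apply, Pi.single_apply]
  simp_rw [h]
  rw [Finset.sum_add_distrib, Finset.sum_const, Finset.card_univ, Fintype.card_fin, nsmul_eq_mul]
  congr 1
  conv_rhs => arg 2; rw [hy]
  simp

/-- The right side is the negative of the scale derivative in `hasDerivAt_scaledKernel`. Changing
the scale is therefore taking a divergence in w, which integration by parts moves onto u. -/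
theorem sum_fderiv_scaledKernel (hφ : Differentiable ℝ φ) (r : ℝ)
    (x w : EuclideanSpace ℝ (Fin n)) :
    ∑ i, fderiv ℝ (scaledKernel (fun v => φ v * v i) r x) w (EuclideanSpace.single i 1)
      = (r ^ (n + 1))⁻¹ * (n * φ (r⁻¹ • (w - x))
        + fderiv ℝ φ (r⁻¹ • (w - x)) (r⁻¹ • (w - x))) := by
  have hd : ∀ i, Differentiable ℝ fun v : EuclideanSpace ℝ (Fin n) => φ v * v i := fun i =>
    hφ.mul (EuclideanSpace.proj (𝕜 := ℝ) i : EuclideanSpace ℝ (Fin n) →L[ℝ] ℝ).differentiable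
  simp_rw [fun i => fderiv_scaledKernel (hd i) r x w, ← Finset.mul_sum, sum_fderiv_mul_coord hφ]
  rw [pow_succ, mul_inv, mul_assoc]

end Kernel

/-! ### Hölder and Morrey estimates for means -/

section Mean

variable {n : ℕ} {Ω : Set (EuclideanSpace ℝ (Fin n))} {φ : EuclideanSpace ℝ (Fin n) → ℝ}

/-- Hölder's inequality for means over a small ball. -/
theorem abs_kernelMean_le {ν : EuclideanSpace ℝ (Fin n)} {ρ M : ℝ} (hρ : 0 ≤ ρ)
    (hs : ∀ v, v ∉ Metric.closedBall ν ρ → φ v = 0) (hM : ∀ v, |φ v| ≤ M)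
    {p : ℝ≥0∞} (hp : 1 ≤ p) {h : EuclideanSpace ℝ (Fin n) → ℝ}
    (hh : MemLp h p (volume.restrict Ω)) {r : ℝ} (hr : 0 < r) (x : EuclideanSpace ℝ (Fin n)) :
    |kernelMean Ω φ h r x| ≤ M * (ρ ^ n * (volume : Measure (EuclideanSpace ℝ (Fin n))).real
        (Metric.closedBall 0 1)) ^ (1 - 1 / p.toReal) * r ^ (-(n / p.toReal))
      * (eLpNorm h p (volume.restrict Ω)).toReal := by
  have hM0 : 0 ≤ M := (abs_nonneg _).trans (hM 0)
  set B := Metric.closedBall (x + r • ν) (r * ρ) with hB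
  set μ := (volume.restrict Ω).restrict B with hμ
  have hμu : μ univ ≤ volume B := by
    rw [hμ, Measure.restrict_apply_univ]
    exact Measure.restrict_apply_le _ _
  have hBfin : volume B < ⊤ := measure_closedBall_lt_top
  have : IsFiniteMeasure μ := ⟨hμu.trans_lt hBfin⟩
  have hhμ : MemLp h p μ := hh.restrict B
  have h1 : MemLp h 1 μ := hhμ.mono_exponent hp
  -- For p = ∞ the conventions `ENNReal.toReal ⊤ = 0` and division by zero give 1/p = 0, the right
  -- exponent.
  have hexp : 0 ≤ 1 - 1 / p.toReal := by
    rcases eq_or_ne p ⊤ with rfl | hpt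
    · simp
    · have : 1 ≤ p.toReal := by
        rw [← ENNReal.toReal_one]; exact ENNReal.toReal_mono hpt hp
      rw [sub_nonneg]; exact (div_le_one (by linarith)).2 this
  have hvol : (volume B).toReal = r ^ n * (ρ ^ n *
      (volume : Measure (EuclideanSpace ℝ (Fin n))).real (Metric.closedBall 0 1)) := by
    rw [hB, Measure.addHaar_closedBall' _ _ (by positivity), ENNReal.toReal_mul,
      ENNReal.toReal_ofReal (by positivity), finrank_euclideanSpace, Fintype.card_fin, mul_pow,
      mul_assoc]
    rfl
  have hle : (eLpNorm h 1 μ).toReal ≤ (eLpNorm h p (volume.restrict Ω)).toReal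
      * (volume B).toReal ^ (1 - 1 / p.toReal) := by
    rw [ENNReal.toReal_rpow, ← ENNReal.toReal_mul]
    refine ENNReal.toReal_mono (ENNReal.mul_ne_top hh.eLpNorm_ne_top
      (ENNReal.rpow_ne_top_of_nonneg hexp hBfin.ne)) ?_
    refine (eLpNorm_le_eLpNorm_mul_rpow_measure_univ hp hhμ.1).trans ?_
    rw [ENNReal.toReal_one, div_one]
    gcongr
    exact Measure.restrict_le_self
  have hint : kernelMean Ω φ h r x = ∫ w, scaledKernel φ r x w * h w ∂μ := by
    rw [kernelMean, hμ]
    refine (setIntegral_eq_integral_of_forall_compl_eq_zero fun w hw => ?_).symm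
    rw [scaledKernel_eq_zero hs hr hw, zero_mul]
  have hb : |∫ w, scaledKernel φ r x w * h w ∂μ| ≤ (r ^ n)⁻¹ * M * (eLpNorm h 1 μ).toReal := by
    have h2 : (eLpNorm h 1 μ).toReal = ∫ w, |h w| ∂μ := by
      rw [eLpNorm_one_eq_lintegral_enorm, ← integral_norm_eq_lintegral_enorm h1.1]
      rfl
    rw [h2, ← integral_const_mul, ← Real.norm_eq_abs]
    refine norm_integral_le_of_norm_le ((memLp_one_iff_integrable.1 h1).abs.const_mul _)
      (Filter.Eventually.of_forall fun w => ?_)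
    rw [norm_mul]
    exact mul_le_mul_of_nonneg_right (abs_scaledKernel_le hM hr x w) (abs_nonneg _)
  rw [hint]
  refine hb.trans ?_
  refine (mul_le_mul_of_nonneg_left hle (by positivity)).trans (le_of_eq ?_)
  rw [hvol, Real.mul_rpow (by positivity) (by positivity)]
  -- The kernel contributes r^{-n}, Hölder on a ball of volume proportional to r^n contributes
  -- r^{n(1 - 1/p)}.
  have hrp : (r ^ n)⁻¹ * (r ^ n) ^ (1 - 1 / p.toReal) = r ^ (-(n / p.toReal)) := by
    rw [← Real.rpow_natCast, ← Real.rpow_mul hr.le, ← Real.rpow_neg hr.le, ← Real.rpow_add hr]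
    congr 1; ring
  rw [← hrp]; ring

theorem exists_bound_of_eq_zero_off_closedBall {ν : EuclideanSpace ℝ (Fin n)} {ρ : ℝ}
    (hφ : Continuous φ) (hs : ∀ v, v ∉ Metric.closedBall ν ρ → φ v = 0) :
    ∃ M, ∀ v, |φ v| ≤ M :=
  hφ.bounded_above_of_compact_support
    (HasCompactSupport.intro (isCompact_closedBall ν ρ) fun _ hv => hs _ hv)

/-- The derivative of the mean with respect to the scale is a mean of the weak gradient. -/
theorem hasDerivAt_kernelMean {ν : EuclideanSpace ℝ (Fin n)} {ρ : ℝ}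
    (hφ : ContDiff ℝ ∞ φ) (hs : ∀ v, v ∉ Metric.closedBall ν ρ → φ v = 0)
    {u : EuclideanSpace ℝ (Fin n) → ℝ}
    {g : EuclideanSpace ℝ (Fin n) → EuclideanSpace ℝ (Fin n)} (hu : IntegrableOn u Ω)
    (hg : IsWeakGradient Ω u g) {r : ℝ} (hr : 0 < r) {x : EuclideanSpace ℝ (Fin n)}
    (hΩ : Metric.closedBall (x + r • ν) (r * ρ) ⊆ Ω) :
    HasDerivAt (fun r => kernelMean Ω φ u r x)
      (∑ i, kernelMean Ω (fun v => φ v * v i) (fun w => g w i) r x) r := by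
  have hφd : Differentiable ℝ φ := hφ.differentiable (by simp)
  have hsi : ∀ i v, v ∉ Metric.closedBall ν ρ → φ v * v i = 0 := fun i v hv => by
    rw [hs v hv, zero_mul]
  have hφi : ∀ i, ContDiff ℝ ∞ fun v : EuclideanSpace ℝ (Fin n) => φ v * v i := fun i =>
    hφ.mul (EuclideanSpace.proj (𝕜 := ℝ) i : EuclideanSpace ℝ (Fin n) →L[ℝ] ℝ).contDiff
  set D : EuclideanSpace ℝ (Fin n) → ℝ := fun v => n * φ v + fderiv ℝ φ v v with hD
  have hDc : Continuous D := by
    have := hφ.continuous_fderiv (by simp)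
    have h3 := hφ.continuous
    fun_prop
  obtain ⟨M, hM⟩ := exists_bound_of_eq_zero_off_closedBall (ν := ν) (ρ := ρ) hDc (fun v hv => by
    have h1 : fderiv ℝ φ v = 0 := by
      refine image_eq_zero_of_notMem_tsupport fun h => hv ?_
      refine closure_minimal (fun v (hv : φ v ≠ 0) => by_contra fun h => hv (hs v h))
        Metric.isClosed_closedBall (tsupport_fderiv_subset ℝ h)
    rw [hD]; simp [h1, hs v hv])
  obtain ⟨M0, hM0⟩ := exists_bound_of_eq_zero_off_closedBall hφ.continuous hs
  have hMn : 0 ≤ M := (abs_nonneg _).trans (hM 0)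
  -- Differentiation under the integral: scales above r/2 keep the negative power of the scale
  -- bounded, and `D` is bounded since it vanishes off a ball.
  have key := (hasDerivAt_integral_of_dominated_loc_of_deriv_le (μ := volume.restrict Ω)
    (F := fun r w => scaledKernel φ r x w * u w)
    (F' := fun r w => -((r ^ (n + 1))⁻¹ * D (r⁻¹ • (w - x))) * u w) (s := Ioi (r / 2)) (x₀ := r)
    (bound := fun w => ((r / 2) ^ (n + 1))⁻¹ * M * |u w|)
    (Ioi_mem_nhds (by linarith)) ?_ ?_ ?_ ?_ ?_ ?_).2
  · refine key.congr_deriv ?_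
    -- The rescaled kernel of φ(v) v_i is a legitimate test function because its supporting ball
    -- lies in Ω.
    have h1 : ∀ i, kernelMean Ω (fun v => φ v * v i) (fun w => g w i) r x
        = -∫ w in Ω, u w * fderiv ℝ (scaledKernel (fun v => φ v * v i) r x) w
            (EuclideanSpace.single i 1) := by
      intro i
      rw [hg _ (contDiff_scaledKernel (hφi i) r x) (hasCompactSupport_scaledKernel (hsi i) hr x)
        ((tsupport_scaledKernel_subset (hsi i) hr x).trans hΩ) i, neg_neg, kernelMean]
      simp_rw [mul_comm]
    simp_rw [h1]
    rw [Finset.sum_neg_distrib, ← integral_finsetSum]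
    · rw [← integral_neg]
      refine integral_congr_ae (Filter.Eventually.of_forall fun w => ?_)
      simp only
      rw [← Finset.mul_sum, sum_fderiv_scaledKernel hφd, hD]
      ring
    · intro i _
      exact integrable_mul_test_fderiv le_rfl (memLp_one_iff_integrable.2 hu)
        (contDiff_scaledKernel (hφi i) r x) (hasCompactSupport_scaledKernel (hsi i) hr x) _
  · exact Filter.Eventually.of_forall fun r =>
      (contDiff_scaledKernel hφ r x).continuous.aestronglyMeasurable.mul hu.1
  · exact hu.integrable.bdd_mul (c := (r ^ n)⁻¹ * M0)
      (contDiff_scaledKernel hφ r x).continuous.aestronglyMeasurable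
      (Filter.Eventually.of_forall fun w => abs_scaledKernel_le hM0 hr x w)
  · refine AEStronglyMeasurable.mul (Continuous.aestronglyMeasurable ?_) hu.1
    fun_prop
  · refine Filter.Eventually.of_forall fun w s hs => ?_
    have hs0 : 0 < s := lt_trans (by positivity) hs
    rw [norm_mul, norm_neg, norm_mul, Real.norm_of_nonneg (by positivity : 0 ≤ (s ^ (n + 1))⁻¹)]
    simp only [Real.norm_eq_abs]
    gcongr
    · exact le_of_lt hs
    · exact hM _
  · exact hu.integrable.abs.const_mul _
  · refine Filter.Eventually.of_forall fun w s hs => ?_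
    have hs0 : 0 < s := lt_trans (by positivity) hs
    exact (hasDerivAt_scaledKernel hφd hs0.ne' x w).mul_const _

/-- Morrey's estimate for means over cones. -/
theorem exists_abs_kernelMean_sub_le {ν : EuclideanSpace ℝ (Fin n)} {ρ : ℝ} (hρ : 0 ≤ ρ)
    (hφ : ContDiff ℝ ∞ φ) (hs : ∀ v, v ∉ Metric.closedBall ν ρ → φ v = 0)
    {p : ℝ≥0∞} (hp : 1 ≤ p) (hpn : n / p.toReal < 1) :
    ∃ C, 0 ≤ C ∧ ∀ (u : EuclideanSpace ℝ (Fin n) → ℝ)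
      (g : EuclideanSpace ℝ (Fin n) → EuclideanSpace ℝ (Fin n)), IntegrableOn u Ω →
      MemLp g p (volume.restrict Ω) → IsWeakGradient Ω u g →
      ∀ (x : EuclideanSpace ℝ (Fin n)) (s r : ℝ), 0 < s → s ≤ r →
        (∀ σ ∈ Icc s r, Metric.closedBall (x + σ • ν) (σ * ρ) ⊆ Ω) →
        |kernelMean Ω φ u r x - kernelMean Ω φ u s x|
          ≤ C * (eLpNorm g p (volume.restrict Ω)).toReal * r ^ (1 - n / p.toReal) := by
  have hφi : ∀ i, ContDiff ℝ ∞ fun v : EuclideanSpace ℝ (Fin n) => φ v * v i := fun i =>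
    hφ.mul (EuclideanSpace.proj (𝕜 := ℝ) i : EuclideanSpace ℝ (Fin n) →L[ℝ] ℝ).contDiff
  have hsi : ∀ i v, v ∉ Metric.closedBall ν ρ → φ v * v i = 0 := fun i v hv => by
    rw [hs v hv, zero_mul]
  choose M hM using fun i => exists_bound_of_eq_zero_off_closedBall (hφi i).continuous (hsi i)
  have hM0 : ∀ i, 0 ≤ M i := fun i => (abs_nonneg _).trans (hM i 0)
  set κ := (ρ ^ n * (volume : Measure (EuclideanSpace ℝ (Fin n))).real
        (Metric.closedBall 0 1)) ^ (1 - 1 / p.toReal) with hκ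
  have hκ0 : 0 ≤ κ := by positivity
  set α := 1 - n / p.toReal with hα
  have hα0 : 0 < α := sub_pos.2 hpn
  set C := ∑ i, M i * κ with hC
  have hC0 : 0 ≤ C := Finset.sum_nonneg fun i _ => mul_nonneg (hM0 i) hκ0
  refine ⟨C / α, by positivity, fun u g hu hgp hg x s r hs0 hsr hcone => ?_⟩
  set N := (eLpNorm g p (volume.restrict Ω)).toReal with hN
  have hder : ∀ σ ∈ Icc s r, HasDerivAt (fun σ => kernelMean Ω φ u σ x - kernelMean Ω φ u s x)
      (∑ i, kernelMean Ω (fun v => φ v * v i) (fun w => g w i) σ x) σ := fun σ hσ =>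
    (hasDerivAt_kernelMean hφ hs hu hg (hs0.trans_le hσ.1) (hcone σ hσ)).sub_const _
  -- The comparison function vanishes at s and is the primitive of the bound C N σ^{-n/p}; this is
  -- where 1/α in the constant comes from.
  have hB : ∀ σ ∈ Icc s r, HasDerivAt (fun σ : ℝ => C * N / α * (σ ^ α - s ^ α))
      (C * N * σ ^ (-(n / p.toReal))) σ := fun σ hσ => by
    have h1 := ((Real.hasDerivAt_rpow_const (p := α)
      (Or.inl (hs0.trans_le hσ.1).ne')).sub_const (s ^ α)).const_mul (C * N / α)
    refine h1.congr_deriv ?_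
    rw [show α - 1 = -(n / p.toReal) by rw [hα]; ring]
    field_simp
  have hbound : ∀ σ ∈ Icc s r,
      ‖∑ i, kernelMean Ω (fun v => φ v * v i) (fun w => g w i) σ x‖
        ≤ C * N * σ ^ (-(n / p.toReal)) := fun σ hσ => by
    have hσ0 := hs0.trans_le hσ.1
    refine (norm_sum_le _ _).trans ?_
    rw [hC, Finset.sum_mul, Finset.sum_mul]
    refine Finset.sum_le_sum fun i _ => ?_
    have hgi : MemLp (fun w => g w i) p (volume.restrict Ω) :=
      (EuclideanSpace.proj (𝕜 := ℝ) i).comp_memLp' hgp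
    refine (abs_kernelMean_le hρ (hsi i) (hM i) hp hgi hσ0 x).trans ?_
    have hle : (eLpNorm (fun w => g w i) p (volume.restrict Ω)).toReal ≤ N := by
      refine ENNReal.toReal_mono hgp.eLpNorm_ne_top (eLpNorm_mono fun w => ?_)
      exact PiLp.norm_apply_le _ _
    calc _ ≤ M i * κ * σ ^ (-(n / p.toReal)) * N := by
          have := hM0 i
          gcongr
      _ = _ := by ring
  have h := image_norm_le_of_norm_deriv_right_le_deriv_boundary'
    (f := fun σ => kernelMean Ω φ u σ x - kernelMean Ω φ u s x)
    (fun σ hσ => (hder σ hσ).continuousAt.continuousWithinAt)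
    (fun σ hσ => (hder σ (Ico_subset_Icc_self hσ)).hasDerivWithinAt)
    (B := fun σ : ℝ => C * N / α * (σ ^ α - s ^ α)) (by simp)
    (fun σ hσ => (hB σ hσ).continuousAt.continuousWithinAt)
    (fun σ hσ => (hB σ (Ico_subset_Icc_self hσ)).hasDerivWithinAt)
    (fun σ hσ => hbound σ (Ico_subset_Icc_self hσ)) (right_mem_Icc.2 hsr)
  refine h.trans ?_
  have hN0 : 0 ≤ N := ENNReal.toReal_nonneg
  have : 0 ≤ s ^ α := by positivity
  calc C * N / α * (r ^ α - s ^ α) ≤ C * N / α * r ^ α := by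
        gcongr
        linarith
    _ = C / α * N * r ^ α := by ring

end Mean

/-! ### Lebesgue differentiation with off-centred kernels -/

open Filter Topology in
/-- Means with respect to an off-centred kernel converge at almost every point. -/
theorem ae_tendsto_kernelMean {n : ℕ} {Ω : Set (EuclideanSpace ℝ (Fin n))}
    (hΩ : MeasurableSet Ω) {φ : EuclideanSpace ℝ (Fin n) → ℝ} {ν : EuclideanSpace ℝ (Fin n)}
    {ρ : ℝ} (hρ : 0 < ρ) (hφ : ContDiff ℝ ∞ φ)
    (hs : ∀ v, v ∉ Metric.closedBall ν ρ → φ v = 0) (h1 : ∫ v, φ v = 1)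
    {u : EuclideanSpace ℝ (Fin n) → ℝ} (hu : IntegrableOn u Ω) :
    ∀ᵐ x ∂(volume.restrict Ω),
      Tendsto (fun r => kernelMean Ω φ u r x) (𝓝[>] 0) (𝓝 (u x)) := by
  obtain ⟨M, hM⟩ := exists_bound_of_eq_zero_off_closedBall hφ.continuous hs
  -- Extension by zero: no cone condition is assumed here, so the balls may leave Ω.
  set f := Ω.indicator u with hf
  have hfi : Integrable f := hu.integrable_indicator hΩ
  -- The balls do not have to contain x: it lies at distance r‖ν‖ from the centre, which is ‖ν‖/ρ
  -- times the radius rρ.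
  have hL := IsUnifLocDoublingMeasure.ae_tendsto_average_norm_sub
    (volume : Measure (EuclideanSpace ℝ (Fin n))) hfi.locallyIntegrable (‖ν‖ / ρ)
  rw [ae_restrict_iff' hΩ]
  filter_upwards [hL] with x hx hxΩ
  have hfx : f x = u x := indicator_of_mem hxΩ u
  rw [← hfx]
  have hlim := hx (l := 𝓝[>] (0 : ℝ)) (fun r => x + r • ν) (fun r => r * ρ) (by
      refine tendsto_nhdsWithin_iff.2 ⟨?_, ?_⟩
      · have : Tendsto (fun r : ℝ => r * ρ) (𝓝 0) (𝓝 (0 * ρ)) := by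
          exact (continuous_id.mul continuous_const).tendsto 0
        rw [zero_mul] at this
        exact this.mono_left nhdsWithin_le_nhds
      · filter_upwards [self_mem_nhdsWithin] with r hr using mul_pos hr hρ) (by
      filter_upwards [self_mem_nhdsWithin] with r hr
      have hr : (0 : ℝ) < r := hr
      rw [Metric.mem_closedBall, dist_eq_norm, sub_add_cancel_left, norm_neg, norm_smul,
        Real.norm_of_nonneg hr.le]
      apply le_of_eq
      field_simp)
  -- M times the volume of a ball of radius ρ, so that M r^{-n} is c divided by the volume of the
  -- ball of radius rρ.
  set c := M * (ρ ^ n * (volume : Measure (EuclideanSpace ℝ (Fin n))).real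
    (Metric.closedBall 0 1)) with hc
  rw [tendsto_iff_norm_sub_tendsto_zero]
  refine squeeze_zero' (Eventually.of_forall fun _ => norm_nonneg _) ?_
    (by simpa using hlim.const_mul c)
  filter_upwards [self_mem_nhdsWithin] with r hr
  have hr : (0 : ℝ) < r := hr
  set k := scaledKernel φ r x with hk
  have hkc : Continuous k := (contDiff_scaledKernel hφ r x).continuous
  have hki : Integrable k :=
    hkc.integrable_of_hasCompactSupport (hasCompactSupport_scaledKernel hs hr x)
  have hk1 : ∫ w, k w = 1 := by
    have : ∀ w, k w = (r ^ n)⁻¹ * (fun y => φ (r⁻¹ • y)) (w - x) := fun w => rfl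
    simp_rw [this]
    rw [integral_const_mul, integral_sub_right_eq_self (fun y => φ (r⁻¹ • y)),
      Measure.integral_comp_smul, h1, finrank_euclideanSpace, Fintype.card_fin, smul_eq_mul,
      mul_one, inv_pow, inv_inv, abs_of_pos (by positivity), inv_mul_cancel₀ (by positivity)]
  have hkf : Integrable fun w => k w * f w := hfi.bdd_mul (c := (r ^ n)⁻¹ * M)
    hkc.aestronglyMeasurable (Eventually.of_forall fun w => abs_scaledKernel_le hM hr x w)
  have hmean : kernelMean Ω φ u r x = ∫ w, k w * f w := by
    rw [kernelMean, ← integral_indicator hΩ]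
    congr 1 with w
    by_cases hw : w ∈ Ω <;> simp [hf, hw, hk]
  have hdiff : kernelMean Ω φ u r x - f x = ∫ w, k w * (f w - f x) := by
    simp_rw [mul_sub]
    rw [integral_sub hkf (hki.mul_const _), integral_mul_const, hk1, one_mul, hmean]
  set B := Metric.closedBall (x + r • ν) (r * ρ) with hB
  have hBi : ∫ w, k w * (f w - f x) = ∫ w in B, k w * (f w - f x) :=
    (setIntegral_eq_integral_of_forall_compl_eq_zero fun w hw => by
      rw [hk, scaledKernel_eq_zero hs hr hw, zero_mul]).symm
  have hBfin : volume B < ⊤ := measure_closedBall_lt_top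
  have hint : IntegrableOn (fun w => ‖f w - f x‖) B :=
    (hfi.integrableOn.sub (integrableOn_const hBfin.ne)).norm
  have hvol : volume.real B = r ^ n * (ρ ^ n *
      (volume : Measure (EuclideanSpace ℝ (Fin n))).real (Metric.closedBall 0 1)) := by
    rw [hB, Measure.addHaar_real_closedBall' _ _ (by positivity), finrank_euclideanSpace,
      Fintype.card_fin, mul_pow, mul_assoc]
  have hvpos : 0 < (volume : Measure (EuclideanSpace ℝ (Fin n))).real (Metric.closedBall 0 1) :=
    ENNReal.toReal_pos (Metric.measure_closedBall_pos _ _ one_pos).ne' measure_closedBall_lt_top.ne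
  rw [hdiff, hBi]
  calc ‖∫ w in B, k w * (f w - f x)‖ ≤ ∫ w in B, (r ^ n)⁻¹ * M * ‖f w - f x‖ := by
        refine norm_integral_le_of_norm_le (hint.const_mul _) (Eventually.of_forall fun w => ?_)
        rw [norm_mul]
        exact mul_le_mul_of_nonneg_right (abs_scaledKernel_le hM hr x w) (norm_nonneg _)
    _ = (r ^ n)⁻¹ * M * ∫ w in B, ‖f w - f x‖ := integral_const_mul _ _
    _ = c * ⨍ w in B, ‖f w - f x‖ := by
        rw [setAverage_eq, smul_eq_mul, hc, hvol]
        field_simp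

/-! ### The interior cone property -/

/-- A bounded Lipschitz domain has the interior cone property, with the same cone for all points
of the domain near a given point of its closure. -/
theorem IsBoundedLipschitzDomain.exists_cone {n : ℕ} {Ω : Set (EuclideanSpace ℝ (Fin n))}
    (hΩ : IsBoundedLipschitzDomain Ω) {x₀ : EuclideanSpace ℝ (Fin n)} (hx₀ : x₀ ∈ closure Ω) :
    ∃ (ν : EuclideanSpace ℝ (Fin n)) (ρ δ r₀ : ℝ), 0 < ρ ∧ 0 < δ ∧ 0 < r₀ ∧
      ∀ x ∈ Ω ∩ Metric.ball x₀ δ, ∀ r, 0 < r → r ≤ r₀ →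
        Metric.closedBall (x + r • ν) (r * ρ) ⊆ Ω := by
  by_cases h : x₀ ∈ Ω
  · obtain ⟨R, hR, hball⟩ := Metric.isOpen_iff.1 hΩ.isOpen x₀ h
    -- At an interior point the cone degenerates to balls centred at x.
    refine ⟨0, 1, R / 2, R / 2, one_pos, by positivity, by positivity, ?_⟩
    rintro x ⟨-, hx⟩ r _ hr w hw
    apply hball
    rw [smul_zero, add_zero, mul_one, Metric.mem_closedBall] at hw
    rw [Metric.mem_ball] at hx ⊢
    linarith [dist_triangle w x x₀]
  · obtain ⟨R, hR, ν, hν, K, γ, hγ, hiff⟩ := hΩ.lipschitz_boundary x₀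
      ⟨hx₀, fun h' => h (interior_subset h')⟩
    have hK : (0 : ℝ) ≤ K := K.2
    -- Moving by rν + e with ‖e‖ ≤ rρ raises the height by at least r - rρ and γ by at most K rρ.
    -- This choice gives (K + 1)ρ < 1, so the point stays above the graph.
    set ρ : ℝ := 1 / (K + 2) with hρ
    have hρ0 : 0 < ρ := by positivity
    have hρK : ρ * (K + 2) = 1 := by rw [hρ]; field_simp
    have hρ1 : ρ ≤ 1 := by nlinarith
    -- As ρ ≤ 1, the ball stays within R/2 + 2R/8 < R of x₀, where the graph description holds.
    refine ⟨ν, ρ, R / 2, R / 8, hρ0, by positivity, by positivity, ?_⟩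
    rintro x ⟨hxΩ, hx⟩ r hr0 hr w hw
    rw [Metric.mem_ball, dist_eq_norm] at hx
    set e := w - (x + r • ν) with he
    have hen : ‖e‖ ≤ r * ρ := by rw [he, ← dist_eq_norm]; exact hw
    have hwe : w = x + r • ν + e := by rw [he]; abel
    have hw_ball : w ∈ Metric.ball x₀ R := by
      rw [Metric.mem_ball, dist_eq_norm, hwe,
        show x + r • ν + e - x₀ = (x - x₀) + r • ν + e by abel]
      have h1 : ‖r • ν‖ = r := by rw [norm_smul, hν, mul_one, Real.norm_of_nonneg hr0.le]
      have h2 : r * ρ ≤ r := by nlinarith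
      linarith [norm_add₃_le (a := x - x₀) (b := r • ν) (c := e)]
    have hx_ball : x ∈ Metric.ball x₀ R := by
      rw [Metric.mem_ball, dist_eq_norm]; linarith
    rw [hiff w hw_ball]
    have hγx := (hiff x hx_ball).1 hxΩ
    set P := (ℝ ∙ ν)ᗮ.orthogonalProjectionOnto with hP
    have hPν : P ν = 0 :=
       Submodule.orthogonalProjectionOnto_orthogonalComplement_singleton_eq_zero ν
    have hPw : P w = P x + P e := by
      rw [hwe, map_add, map_add, map_smul, hPν, smul_zero, add_zero]
    have h1 : γ (P w) - γ (P x) ≤ K * (r * ρ) := by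
      have h2 := hγ.dist_le_mul (P w) (P x)
      rw [Real.dist_eq, dist_eq_norm, hPw, add_sub_cancel_left] at h2
      have h3 : ‖P e‖ ≤ r * ρ :=
        ((ℝ ∙ ν)ᗮ.norm_orthogonalProjectionOnto_apply_le e).trans hen
      rw [hPw]
      exact (le_abs_self _).trans (h2.trans (by gcongr))
    have h4 : inner ℝ ν w = inner ℝ ν x + r + inner ℝ ν e := by
      rw [hwe, inner_add_right, inner_add_right, inner_smul_right, real_inner_self_eq_norm_sq, hν]
      ring
    have h5 : -(r * ρ) ≤ inner ℝ ν e := by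
      have := abs_real_inner_le_norm ν e
      rw [hν, one_mul] at this
      linarith [neg_abs_le (inner ℝ ν e)]
    have h6 : (K : ℝ) * (r * ρ) < r - r * ρ := by nlinarith [mul_pos hr0 hρ0]
    linarith

/-! ### Local and global continuous representatives -/

open Filter Topology

theorem kernelMean_congr {n : ℕ} {Ω : Set (EuclideanSpace ℝ (Fin n))}
    {φ u v : EuclideanSpace ℝ (Fin n) → ℝ} (h : u =ᵐ[volume.restrict Ω] v) (r : ℝ)
    (x : EuclideanSpace ℝ (Fin n)) : kernelMean Ω φ u r x = kernelMean Ω φ v r x :=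
  integral_congr_ae (by filter_upwards [h] with w hw; rw [hw])

/-- Means of a continuous curve in `L^2` depend continuously on the point and on the time. -/
theorem continuous_kernelMean {n : ℕ} {Ω : Set (EuclideanSpace ℝ (Fin n))}
    [IsFiniteMeasure (volume.restrict Ω)] {φ : EuclideanSpace ℝ (Fin n) → ℝ}
    {ν : EuclideanSpace ℝ (Fin n)} {ρ : ℝ} (hρ : 0 ≤ ρ) (hφ : ContDiff ℝ ∞ φ)
    (hs : ∀ v, v ∉ Metric.closedBall ν ρ → φ v = 0) {V : ℝ → LSpace Ω 2} (hV : Continuous V)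
    {r : ℝ} (hr : 0 < r) :
    Continuous fun q : EuclideanSpace ℝ (Fin n) × ℝ => kernelMean Ω φ (V q.2) r q.1 := by
  obtain ⟨M, hM⟩ := exists_bound_of_eq_zero_off_closedBall hφ.continuous hs
  have hint : ∀ (v : LSpace Ω 2), Integrable v (volume.restrict Ω) := fun v =>
    (Lp.memLp v).integrable (by norm_num)
  have hkint : ∀ (v : LSpace Ω 2) x,
      Integrable (fun w => scaledKernel φ r x w * v w) (volume.restrict Ω) := fun v x =>
    (hint v).bdd_mul (c := (r ^ n)⁻¹ * M)
      (contDiff_scaledKernel hφ r x).continuous.aestronglyMeasurable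
      (Eventually.of_forall fun w => abs_scaledKernel_le hM hr x w)
  rw [continuous_iff_continuousAt]
  rintro ⟨x₀, t₀⟩
  -- The first term is small uniformly in x, by Hölder with exponent 2; the second involves a fixed
  -- function and is continuous in x.
  have hsplit : ∀ q : EuclideanSpace ℝ (Fin n) × ℝ, kernelMean Ω φ (V q.2) r q.1
      = kernelMean Ω φ (V q.2 - V t₀ : LSpace Ω 2) r q.1 + kernelMean Ω φ (V t₀) r q.1 := by
    intro q
    rw [kernelMean_congr (Lp.coeFn_sub (V q.2) (V t₀)), kernelMean, kernelMean, kernelMean,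
      ← integral_add]
    · congr 1 with w
      rw [Pi.sub_apply]; ring
    · refine ((hkint (V q.2) q.1).sub (hkint (V t₀) q.1)).congr (Eventually.of_forall fun w => ?_)
      simp only [Pi.sub_apply, mul_sub]
    · exact hkint _ _
  have h1 : Tendsto (fun q : EuclideanSpace ℝ (Fin n) × ℝ =>
      kernelMean Ω φ (V q.2 - V t₀ : LSpace Ω 2) r q.1) (𝓝 (x₀, t₀)) (𝓝 0) := by
    set c := M * (ρ ^ n * (volume : Measure (EuclideanSpace ℝ (Fin n))).real
      (Metric.closedBall 0 1)) ^ (1 - 1 / (2 : ℝ≥0∞).toReal) * r ^ (-(n / (2 : ℝ≥0∞).toReal))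
    have hc : Continuous fun q : EuclideanSpace ℝ (Fin n) × ℝ => c * ‖V q.2 - V t₀‖ := by
      fun_prop
    have h0 : Tendsto (fun q : EuclideanSpace ℝ (Fin n) × ℝ => c * ‖V q.2 - V t₀‖)
        (𝓝 (x₀, t₀)) (𝓝 0) := by simpa using hc.tendsto (x₀, t₀)
    refine squeeze_zero_norm (fun q => ?_) h0
    rw [Lp.norm_def]
    exact abs_kernelMean_le hρ hs hM (by norm_num) (Lp.memLp _) hr q.1
  have h2 : Continuous fun x => kernelMean Ω φ (V t₀) r x := by
    refine continuous_of_dominated (bound := fun w => (r ^ n)⁻¹ * M * |V t₀ w|)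
      (fun x => (hkint (V t₀) x).1) (fun x => Eventually.of_forall fun w => ?_)
      ((hint _).abs.const_mul _) (Eventually.of_forall fun w => ?_)
    · rw [norm_mul]
      exact mul_le_mul_of_nonneg_right (abs_scaledKernel_le hM hr x w) (abs_nonneg _)
    · have := hφ.continuous
      unfold scaledKernel
      fun_prop
  have h3 := h1.add ((h2.comp continuous_fst).tendsto (x₀, t₀))
  rw [zero_add] at h3
  exact h3.congr fun q => (hsplit q).symm

/-- A bound that holds at points of `Ω` near `x₀` and at almost every time extends to the closure,
for continuous functions. -/
theorem abs_le_of_ae_time {n : ℕ} {Ω B : Set (EuclideanSpace ℝ (Fin n))} (hB : IsOpen B) {T : ℝ}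
    (hT : 0 < T) {P : ℝ → Prop} (hP : ∀ᵐ t ∂(volume.restrict (Ioo 0 T)), P t)
    {f : EuclideanSpace ℝ (Fin n) × ℝ → ℝ} (hf : Continuous f) {c : ℝ}
    (h : ∀ x ∈ Ω ∩ B, ∀ t, P t → |f (x, t)| ≤ c) :
    ∀ q ∈ (closure Ω ∩ B) ×ˢ Icc 0 T, |f q| ≤ c := by
  rintro ⟨x, t⟩ ⟨hx, ht⟩
  have hcl : IsClosed {q | |f q| ≤ c} := isClosed_le hf.abs continuous_const
  have hx' : x ∈ closure (Ω ∩ B) := by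
    rw [inter_comm]; rw [inter_comm] at hx
    exact hB.inter_closure hx
  have ht' : t ∈ closure {t | P t} := by
    -- A set of full measure in an open interval is dense there.
    have h1 : Ioo 0 T ⊆ closure {t | P t} := by
      intro s hs
      rw [mem_closure_iff]
      intro o ho hso
      by_contra hne
      have h2 : ∀ᵐ t ∂(volume.restrict (Ioo 0 T)), t ∉ o := by
        filter_upwards [hP] with t ht hto using hne ⟨t, hto, ht⟩
      rw [ae_restrict_iff' measurableSet_Ioo] at h2
      have h3 : volume (o ∩ Ioo 0 T) = 0 := by
        refine measure_mono_null ?_ (ae_iff.1 h2)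
        rintro t ⟨h4, h5⟩ h6
        exact h6 h5 h4
      exact ((ho.inter isOpen_Ioo).measure_pos volume ⟨s, hso, hs⟩).ne' h3
    rw [← closure_Ioo hT.ne] at ht
    exact closure_minimal h1 isClosed_closure ht
  have hmem : (x, t) ∈ closure ((Ω ∩ B) ×ˢ {t | P t}) := by
    rw [closure_prod_eq]; exact ⟨hx', ht'⟩
  exact closure_minimal (fun q hq => h q.1 hq.1 q.2 hq.2) hcl hmem

theorem W1p.norm_fst_le {n : ℕ} {Ω : Set (EuclideanSpace ℝ (Fin n))} {p : ℝ≥0∞} [Fact (1 ≤ p)]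
    (w : W1p Ω p) : (eLpNorm w.1.1 p (volume.restrict Ω)).toReal ≤ ‖w‖ := by
  rw [← Lp.norm_def]; exact _root_.norm_fst_le w.1

theorem W1p.norm_snd_le {n : ℕ} {Ω : Set (EuclideanSpace ℝ (Fin n))} {p : ℝ≥0∞} [Fact (1 ≤ p)]
    (w : W1p Ω p) : (eLpNorm w.1.2 p (volume.restrict Ω)).toReal ≤ ‖w‖ := by
  rw [← Lp.norm_def]; exact _root_.norm_snd_le w.1

/-- Near each point of the closure of the domain, a bounded curve in `W^{1,p}` that is continuous
in `L^2` has a representative that is continuous in space and time. -/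
theorem IsBoundedLipschitzDomain.exists_local_continuous {n : ℕ}
    {Ω : Set (EuclideanSpace ℝ (Fin n))} (hΩ : IsBoundedLipschitzDomain Ω) {T : ℝ} (hT : 0 < T)
    {p : ℝ≥0∞} [Fact (1 ≤ p)] (hp : (n : ℝ≥0∞) < p) {x₀ : EuclideanSpace ℝ (Fin n)}
    (hx₀ : x₀ ∈ closure Ω) :
    ∃ δ C : ℝ, 0 < δ ∧ 0 ≤ C ∧ ∀ (V : ℝ → LSpace Ω 2) (u : ℝ → W1p Ω p) (N : ℝ), Continuous V →
      (∀ᵐ t ∂(volume.restrict (Ioo 0 T)), ‖u t‖ ≤ N ∧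
        W1p.toLSpace (u t) =ᵐ[volume.restrict Ω] V t) →
      ∃ F : EuclideanSpace ℝ (Fin n) × ℝ → ℝ,
        ContinuousOn F ((closure Ω ∩ Metric.ball x₀ δ) ×ˢ Icc 0 T) ∧
        (∀ q ∈ (closure Ω ∩ Metric.ball x₀ δ) ×ˢ Icc 0 T, |F q| ≤ C * N) ∧
        ∀ᵐ t ∂(volume.restrict (Ioo 0 T)), ∀ᵐ x ∂(volume.restrict Ω),
          x ∈ Metric.ball x₀ δ → F (x, t) = W1p.toLSpace (u t) x := by
  have hp1 : 1 ≤ p := Fact.out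
  have hfin : IsFiniteMeasure (volume.restrict Ω) :=
    ⟨by rw [Measure.restrict_apply_univ]; exact hΩ.isBounded.measure_lt_top⟩
  obtain ⟨ν, ρ, δ, r₀, hρ, hδ, hr₀, hcone⟩ := hΩ.exists_cone hx₀
  let b : ContDiffBump ν := ⟨ρ / 2, ρ, by positivity, by linarith⟩
  set φ := b.normed volume with hφdef
  have hφ : ContDiff ℝ ∞ φ := b.contDiff_normed
  have hs : ∀ v, v ∉ Metric.closedBall ν ρ → φ v = 0 := fun v hv => by
    refine image_eq_zero_of_notMem_tsupport ?_
    rw [hφdef, b.tsupport_normed_eq]; exact hv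
  have hφ1 : ∫ v, φ v = 1 := b.integral_normed
  obtain ⟨M, hM⟩ := exists_bound_of_eq_zero_off_closedBall hφ.continuous hs
  have hM0 : 0 ≤ M := (abs_nonneg _).trans (hM 0)
  have hpn : n / p.toReal < 1 := by
    rcases eq_or_ne p ⊤ with rfl | hpt
    · simp
    · have h1 : (n : ℝ) < p.toReal := by
        rw [← ENNReal.toReal_natCast]
        exact (ENNReal.toReal_lt_toReal (ENNReal.natCast_ne_top n) hpt).2 hp
      exact (div_lt_one ((Nat.cast_nonneg n).trans_lt h1)).2 h1
  obtain ⟨C₁, hC₁, hmorrey⟩ := exists_abs_kernelMean_sub_le (Ω := Ω) hρ.le hφ hs hp1 hpn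
  set α := 1 - n / p.toReal with hα
  have hα0 : 0 < α := sub_pos.2 hpn
  set C₂ := M * (ρ ^ n * (volume : Measure (EuclideanSpace ℝ (Fin n))).real
    (Metric.closedBall 0 1)) ^ (1 - 1 / p.toReal) * r₀ ^ (-(n / p.toReal)) with hC₂def
  have hC₂ : 0 ≤ C₂ := by positivity
  -- C₂ bounds the mean at scale r₀ by Hölder; C₁ r₀^α bounds its distance to the limit by Morrey.
  refine ⟨δ, C₂ + C₁ * r₀ ^ α, hδ, by positivity, fun V u N hV hu => ?_⟩
  set S := (closure Ω ∩ Metric.ball x₀ δ) ×ˢ Icc 0 T with hS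
  set A : ℝ → EuclideanSpace ℝ (Fin n) × ℝ → ℝ := fun r q => kernelMean Ω φ (V q.2) r q.1
  have hA : ∀ {r}, 0 < r → Continuous (A r) := fun hr => continuous_kernelMean hρ.le hφ hs hV hr
  have hi : ∀ t, IntegrableOn (W1p.toLSpace (u t)) Ω := fun t =>
    (Lp.memLp (W1p.toLSpace (u t))).integrable hp1
  -- Morrey applies to u(t) at almost every t and x in Ω. There the means of u(t) and V(t) coincide,
  -- and the latter are continuous, so the bound passes to all of `S`.
  have hAd : ∀ r s, 0 < s → s ≤ r → r ≤ r₀ → ∀ q ∈ S, |A r q - A s q| ≤ C₁ * N * r ^ α := by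
    intro r s hs0 hsr hr
    refine abs_le_of_ae_time Metric.isOpen_ball hT hu
      ((hA (hs0.trans_le hsr)).sub (hA hs0)) fun x hx t ht => ?_
    have h1 := hmorrey (W1p.toLSpace (u t)) (u t).1.2 (hi t) (Lp.memLp _) (u t).2 x s r hs0 hsr
      fun σ hσ => hcone x hx σ (hs0.trans_le hσ.1) (hσ.2.trans hr)
    rw [kernelMean_congr ht.2, kernelMean_congr ht.2] at h1
    refine h1.trans ?_
    have := (W1p.norm_snd_le (u t)).trans ht.1
    have : 0 < r := hs0.trans_le hsr
    gcongr
  have hAb : ∀ q ∈ S, |A r₀ q| ≤ C₂ * N := by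
    refine abs_le_of_ae_time Metric.isOpen_ball hT hu (hA hr₀) fun x hx t ht => ?_
    have h1 := abs_kernelMean_le hρ.le hs hM hp1 (Lp.memLp (W1p.toLSpace (u t))) hr₀ x
    rw [kernelMean_congr ht.2] at h1
    exact h1.trans (mul_le_mul_of_nonneg_left ((W1p.norm_fst_le (u t)).trans ht.1) hC₂)
  have hN : 0 ≤ N := by
    have : (ae (volume.restrict (Ioo 0 T))).NeBot := by
      rw [ae_restrict_neBot, Real.volume_Ioo]
      simpa using hT
    obtain ⟨t, ht⟩ := hu.exists
    exact (norm_nonneg _).trans ht.1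
  -- The sequence starts at r₀, so that the error bound at j = 0 also bounds the limit.
  set r : ℕ → ℝ := fun j => r₀ / (j + 1) with hr
  have hrpos : ∀ j, 0 < r j := fun j => by positivity
  have hranti : Antitone r := fun i j hij => by
    simp only [hr]; gcongr
  have hr0 : r 0 = r₀ := by simp [hr]
  have hrle : ∀ j, r j ≤ r₀ := fun j => by rw [← hr0]; exact hranti (Nat.zero_le j)
  have hrlim : Tendsto r atTop (𝓝 0) := by
    have := (tendsto_one_div_add_atTop_nhds_zero_nat (𝕜 := ℝ)).const_mul r₀
    simpa [hr, div_eq_mul_inv] using this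
  have hrlim' : Tendsto r atTop (𝓝[>] 0) :=
    tendsto_nhdsWithin_iff.2 ⟨hrlim, Eventually.of_forall hrpos⟩
  have hblim : Tendsto (fun j => C₁ * N * r j ^ α) atTop (𝓝 0) := by
    have := (hrlim.rpow_const (p := α) (Or.inr hα0.le)).const_mul (C₁ * N)
    rwa [Real.zero_rpow hα0.ne', mul_zero] at this
  have hdist : ∀ q ∈ S, ∀ i j, i ≤ j → |A (r i) q - A (r j) q| ≤ C₁ * N * r i ^ α :=
    fun q hq i j hij => hAd _ _ (hrpos j) (hranti hij) (hrle i) q hq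
  have hcauchy : ∀ q ∈ S, CauchySeq fun j => A (r j) q := fun q hq =>
    cauchySeq_of_le_tendsto_0' (fun j => C₁ * N * r j ^ α)
      (fun i j hij => hdist q hq i j hij) hblim
  have hex : ∀ q, ∃ y, q ∈ S → Tendsto (fun j => A (r j) q) atTop (𝓝 y) := fun q => by
    by_cases hq : q ∈ S
    · obtain ⟨y, hy⟩ := cauchySeq_tendsto_of_complete (hcauchy q hq)
      exact ⟨y, fun _ => hy⟩
    · exact ⟨0, fun h => absurd h hq⟩
  choose F hF using hex
  have hAF : ∀ q ∈ S, ∀ j, |A (r j) q - F q| ≤ C₁ * N * r j ^ α := fun q hq j =>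
    le_of_tendsto ((tendsto_const_nhds.sub (hF q hq)).abs)
      ((eventually_ge_atTop j).mono fun k hk => hdist q hq j k hk)
  refine ⟨F, ?_, ?_, ?_⟩
  · have hunif : TendstoUniformlyOn (fun j => A (r j)) F atTop S := by
      rw [Metric.tendstoUniformlyOn_iff]
      intro ε hε
      filter_upwards [hblim.eventually_lt_const hε] with j hj q hq
      rw [dist_comm]
      exact (hAF q hq j).trans_lt hj
    exact hunif.continuousOn (Frequently.of_forall fun j => (hA (hrpos j)).continuousOn)
  · intro q hq
    have h1 := hAF q hq 0
    rw [hr0] at h1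
    have h2 := hAb q hq
    have h3 : |F q| ≤ |A r₀ q| + |A r₀ q - F q| := by
      have := abs_sub_abs_le_abs_sub (F q) (A r₀ q)
      rw [abs_sub_comm] at this
      linarith
    calc |F q| ≤ C₂ * N + C₁ * N * r₀ ^ α := by linarith
      _ = _ := by ring
  · filter_upwards [hu, ae_restrict_mem measurableSet_Ioo] with t ht htT
    filter_upwards [ae_tendsto_kernelMean hΩ.isOpen.measurableSet hρ hφ hs hφ1 (hi t),
      ae_restrict_mem hΩ.isOpen.measurableSet] with x hx hxΩ hxB
    have hq : (x, t) ∈ S := ⟨⟨subset_closure hxΩ, hxB⟩, Ioo_subset_Icc_self htT⟩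
    -- F(x,t) and u(t)(x) are limits of the same means.
    refine tendsto_nhds_unique (hF _ hq) ((hx.comp hrlim').congr fun j => ?_)
    exact kernelMean_congr ht.2 _ _

/-- Continuous functions near the points of the closure of the domain are glued with a partition of
unity. -/
theorem IsBoundedLipschitzDomain.exists_continuous {n : ℕ}
    {Ω : Set (EuclideanSpace ℝ (Fin n))} (hΩ : IsBoundedLipschitzDomain Ω) {T : ℝ} (hT : 0 < T)
    {p : ℝ≥0∞} [Fact (1 ≤ p)] (hp : (n : ℝ≥0∞) < p) :
    ∃ C : ℝ, ∀ (V : ℝ → LSpace Ω 2) (u : ℝ → W1p Ω p) (N : ℝ), Continuous V →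
      (∀ᵐ t ∂(volume.restrict (Ioo 0 T)), ‖u t‖ ≤ N ∧
        W1p.toLSpace (u t) =ᵐ[volume.restrict Ω] V t) →
      ∃ G : EuclideanSpace ℝ (Fin n) × ℝ → ℝ, ContinuousOn G (closure Ω ×ˢ Icc 0 T) ∧
        (∀ q ∈ closure Ω ×ˢ Icc 0 T, |G q| ≤ C * N) ∧
        ∀ᵐ t ∂(volume.restrict (Ioo 0 T)), ∀ᵐ x ∂(volume.restrict Ω),
          G (x, t) = W1p.toLSpace (u t) x := by
  -- Radius and constant depend on x₀ only, so one finite cover serves all curves and the final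
  -- constant is uniform.
  choose! δ C hδ hC hloc using fun (x₀ : EuclideanSpace ℝ (Fin n)) (hx₀ : x₀ ∈ closure Ω) =>
    hΩ.exists_local_continuous hT hp hx₀
  have hcomp : IsCompact (closure Ω) := hΩ.isBounded.isCompact_closure
  obtain ⟨s, hsΩ, hcover⟩ := hcomp.elim_nhds_subcover (fun x => Metric.ball x (δ x))
    fun x hx => Metric.ball_mem_nhds x (hδ x hx)
  obtain ⟨f, hf⟩ := PartitionOfUnity.exists_isSubordinate (s := closure Ω) isClosed_closure
    (fun i : s => Metric.ball (i : EuclideanSpace ℝ (Fin n)) (δ i))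
    (fun _ => Metric.isOpen_ball) fun x hx => by simpa using hcover hx
  have hsum : ∀ x ∈ closure Ω, ∑ i, f i x = 1 := fun x hx => by
    rw [← finsum_eq_sum_of_fintype]; exact f.sum_eq_one hx
  refine ⟨∑ i : s, C i, fun V u N hV hu => ?_⟩
  choose F hFc hFb hFe using fun i : s => hloc i (hsΩ i i.2) V u N hV hu
  have hball : ∀ (i : s) x, f i x ≠ 0 → x ∈ Metric.ball (i : EuclideanSpace ℝ (Fin n)) (δ i) :=
    fun i x hx => hf i (subset_tsupport _ hx)
  refine ⟨fun q => ∑ i, f i q.1 * F i q, ?_, ?_, ?_⟩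
  · refine continuousOn_finsetSum _ fun i _ => ?_
    rintro ⟨x, t⟩ ⟨hx, ht⟩
    -- F_i is continuous only over its ball, which contains the support of f_i; off that support the
    -- product vanishes locally.
    by_cases hxs : x ∈ tsupport (f i)
    · have hxb := hf i hxs
      refine ((f i).continuous.comp continuous_fst).continuousWithinAt.mul ?_
      refine (hFc i (x, t) ⟨⟨hx, hxb⟩, ht⟩).mono_of_mem_nhdsWithin ?_
      have h1 : Prod.fst ⁻¹' Metric.ball (i : EuclideanSpace ℝ (Fin n)) (δ i) ∈ 𝓝 (x, t) :=
        continuous_fst.continuousAt (Metric.isOpen_ball.mem_nhds hxb)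
      filter_upwards [self_mem_nhdsWithin, mem_nhdsWithin_of_mem_nhds h1] with q hq hqb
        using ⟨⟨hq.1, hqb⟩, hq.2⟩
    · have h1 : Prod.fst ⁻¹' (tsupport (f i))ᶜ ∈ 𝓝 (x, t) :=
        continuous_fst.continuousAt ((isClosed_tsupport _).isOpen_compl.mem_nhds hxs)
      refine ContinuousAt.continuousWithinAt ?_
      refine (continuousAt_const (y := (0 : ℝ))).congr ?_
      filter_upwards [h1] with q hq
      rw [image_eq_zero_of_notMem_tsupport hq, zero_mul]
  · rintro ⟨x, t⟩ ⟨hx, ht⟩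
    refine (Finset.abs_sum_le_sum_abs _ _).trans ?_
    rw [Finset.sum_mul]
    refine Finset.sum_le_sum fun i _ => ?_
    have hN : 0 ≤ N := by
      have : (ae (volume.restrict (Ioo 0 T))).NeBot := by
        rw [ae_restrict_neBot, Real.volume_Ioo]
        simpa using hT
      obtain ⟨t, ht⟩ := hu.exists
      exact (norm_nonneg _).trans ht.1
    have hCN : 0 ≤ C i * N := mul_nonneg (hC i (hsΩ i i.2)) hN
    by_cases hfx : f i x = 0
    · simpa [hfx] using hCN
    · rw [abs_mul, abs_of_nonneg (f.nonneg i x)]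
      calc f i x * |F i (x, t)| ≤ 1 * (C i * N) :=
            mul_le_mul (f.le_one i x) (hFb i _ ⟨⟨hx, hball i x hfx⟩, ht⟩) (abs_nonneg _) zero_le_one
        _ = _ := one_mul _
  · filter_upwards [ae_all_iff.2 hFe] with t ht
    filter_upwards [ae_all_iff.2 ht, ae_restrict_mem hΩ.isOpen.measurableSet] with x hx hxΩ
    have h1 : ∀ i, f i x * F i (x, t) = f i x * W1p.toLSpace (u t) x := fun i => by
      by_cases hfx : f i x = 0
      · simp [hfx]
      · rw [hx i (hball i x hfx)]
    simp only [h1]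
    rw [← Finset.sum_mul, hsum x (subset_closure hxΩ), one_mul]

/-! ### Uniqueness and linearity of the representative -/

theorem ae_norm_le_norm_of_Linfty {X : Type*} [NormedAddCommGroup X] {T : ℝ}
    (u : BochnerSpace T X ∞) : ∀ᵐ t ∂(volume.restrict (Ioo 0 T)), ‖u t‖ ≤ ‖u‖ := by
  filter_upwards [ae_le_eLpNormEssSup (f := u) (μ := volume.restrict (Ioo 0 T))] with t ht
  rw [Lp.norm_def, eLpNorm_exponent_top, ← toReal_enorm]
  refine ENNReal.toReal_mono ?_ ht
  rw [← eLpNorm_exponent_top]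
  exact Lp.eLpNorm_ne_top _

theorem ae_toLSpace_add {n : ℕ} {Ω : Set (EuclideanSpace ℝ (Fin n))} {T : ℝ} {p : ℝ≥0∞}
    [Fact (1 ≤ p)] {u v w : BochnerSpace T (W1p Ω p) ∞} (h : w = u + v) :
    ∀ᵐ t, t ∈ Ioo 0 T → ∀ᵐ x, x ∈ Ω →
      W1p.toLSpace (w t) x = W1p.toLSpace (u t) x + W1p.toLSpace (v t) x := by
  subst h
  refine (ae_restrict_iff' measurableSet_Ioo).1 ?_
  filter_upwards [Lp.coeFn_add u v] with t ht
  rw [ht, Pi.add_apply, map_add]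
  exact ae_imp_of_ae_restrict (Lp.coeFn_add _ _)

theorem ae_toLSpace_smul {n : ℕ} {Ω : Set (EuclideanSpace ℝ (Fin n))} {T : ℝ} {p : ℝ≥0∞}
    [Fact (1 ≤ p)] {c : ℝ} {u w : BochnerSpace T (W1p Ω p) ∞} (h : w = c • u) :
    ∀ᵐ t, t ∈ Ioo 0 T → ∀ᵐ x, x ∈ Ω → W1p.toLSpace (w t) x = c * W1p.toLSpace (u t) x := by
  subst h
  refine (ae_restrict_iff' measurableSet_Ioo).1 ?_
  filter_upwards [Lp.coeFn_smul c u] with t ht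
  rw [ht, Pi.smul_apply, map_smul]
  exact ae_imp_of_ae_restrict (Lp.coeFn_smul _ _)

/-- A relation between a normed space and a space of continuous functions that is total with a
linear bound, functional, compatible with the operations and relates only `0` to `0` is the graph of
a bounded injective linear map. -/
theorem exists_injective_linearMap_of_relation {Z K : Type*} [SeminormedAddCommGroup Z] [Module ℝ Z]
    [TopologicalSpace K] (r : Z → C(K, ℝ) → Prop)
    (hex : ∃ C : ℝ, ∀ z, ∃ G, r z G ∧ ∀ y, |G y| ≤ C * ‖z‖)
    (hunique : ∀ z G H, r z G → r z H → G = H)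
    (hadd : ∀ z z' G H, r z G → r z' H → r (z + z') (G + H))
    (hsmul : ∀ (c : ℝ) z G, r z G → r (c • z) (c • G)) (hzero : ∀ z, r z 0 → z = 0) :
    ∃ ι : Z →ₗ[ℝ] C(K, ℝ), (∀ z, r z (ι z)) ∧ Function.Injective ι ∧
      ∃ C : ℝ, ∀ z y, |ι z y| ≤ C * ‖z‖ := by
  obtain ⟨C, hC⟩ := hex
  choose f hf hb using hC
  let ι : Z →ₗ[ℝ] C(K, ℝ) :=
    { toFun := f
      map_add' := fun z z' => hunique _ _ _ (hf _) (hadd _ _ _ _ (hf z) (hf z'))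
      map_smul' := fun c z => hunique _ _ _ (hf _) (hsmul c _ _ (hf z)) }
  refine ⟨ι, hf, (injective_iff_map_eq_zero ι).2 fun z hz => hzero z ?_, C, hb⟩
  rw [← hz]; exact hf z

/-- The continuous function `G` on the closed space-time cylinder represents the function `e`. -/
def Represents {n : ℕ} {Ω : Set (EuclideanSpace ℝ (Fin n))} {T : ℝ}
    (G : C(closure (Ω ×ˢ Ioo (0 : ℝ) T), ℝ)) (e : ℝ → EuclideanSpace ℝ (Fin n) → ℝ) : Prop :=
  ∀ᵐ t : ℝ, ∀ ht : t ∈ Ioo 0 T, ∀ᵐ x : EuclideanSpace ℝ (Fin n), ∀ hx : x ∈ Ω,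
    G ⟨(x, t), subset_closure ⟨hx, ht⟩⟩ = e t x

section Represents

variable {n : ℕ} {Ω : Set (EuclideanSpace ℝ (Fin n))} {T : ℝ}

/-- Continuous functions equal almost everywhere on an open set are equal there. This is used in x
at almost every time, then in t at every x; density of the open cylinder in its closure does the
rest. -/
theorem Represents.unique (hΩ : IsOpen Ω) {e : ℝ → EuclideanSpace ℝ (Fin n) → ℝ}
    {G H : C(closure (Ω ×ˢ Ioo (0 : ℝ) T), ℝ)} (hG : Represents G e)
    (hH : Represents H e) : G = H := by
  set G' : EuclideanSpace ℝ (Fin n) × ℝ → ℝ := Function.extend Subtype.val G 0 with hG'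
  set H' : EuclideanSpace ℝ (Fin n) × ℝ → ℝ := Function.extend Subtype.val H 0 with hH'
  have hGe : ∀ y (hy : y ∈ closure (Ω ×ˢ Ioo (0 : ℝ) T)), G' y = G ⟨y, hy⟩ := fun y hy =>
    Subtype.val_injective.extend_apply G 0 ⟨y, hy⟩
  have hHe : ∀ y (hy : y ∈ closure (Ω ×ˢ Ioo (0 : ℝ) T)), H' y = H ⟨y, hy⟩ := fun y hy =>
    Subtype.val_injective.extend_apply H 0 ⟨y, hy⟩
  have hcont : ∀ K : C(closure (Ω ×ˢ Ioo (0 : ℝ) T), ℝ),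
      ContinuousOn (Function.extend Subtype.val K 0) (closure (Ω ×ˢ Ioo (0 : ℝ) T)) := fun K => by
    rw [continuousOn_iff_continuous_domRestrict]
    convert K.continuous using 1
    ext y
    exact Subtype.val_injective.extend_apply K 0 y
  have hGc := (hcont G).mono subset_closure
  have hHc := (hcont H).mono subset_closure
  have hx : ∀ {K : EuclideanSpace ℝ (Fin n) × ℝ → ℝ}, ContinuousOn K (Ω ×ˢ Ioo (0 : ℝ) T) →
      ∀ t ∈ Ioo 0 T, ContinuousOn (fun x => K (x, t)) Ω := fun hK t ht =>
    hK.comp (by fun_prop) fun x hx => ⟨hx, ht⟩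
  have ht : ∀ {K : EuclideanSpace ℝ (Fin n) × ℝ → ℝ}, ContinuousOn K (Ω ×ˢ Ioo (0 : ℝ) T) →
      ∀ x ∈ Ω, ContinuousOn (fun t => K (x, t)) (Ioo 0 T) := fun hK x hx =>
    hK.comp (by fun_prop) fun t ht => ⟨hx, ht⟩
  have h1 : ∀ᵐ t ∂(volume.restrict (Ioo 0 T)), ∀ x ∈ Ω, G' (x, t) = H' (x, t) := by
    rw [ae_restrict_iff' measurableSet_Ioo]
    filter_upwards [hG, hH] with t hGt hHt htT
    refine Measure.eqOn_open_of_ae_eq (μ := volume) ?_ hΩ (hx hGc t htT) (hx hHc t htT)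
    refine (ae_restrict_iff' hΩ.measurableSet).2 ?_
    filter_upwards [hGt htT, hHt htT] with x h2 h3 hxΩ
    rw [hGe _ (subset_closure ⟨hxΩ, htT⟩), hHe _ (subset_closure ⟨hxΩ, htT⟩), h2 hxΩ, h3 hxΩ]
  have h2 : EqOn G' H' (Ω ×ˢ Ioo (0 : ℝ) T) := by
    rintro ⟨x, t⟩ ⟨hxΩ, htT⟩
    refine Measure.eqOn_open_of_ae_eq (μ := volume) ?_ isOpen_Ioo (ht hGc x hxΩ) (ht hHc x hxΩ) htT
    filter_upwards [h1] with t ht using ht x hxΩ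
  have h3 := h2.of_subset_closure (hcont G) (hcont H) subset_closure Subset.rfl
  ext ⟨y, hy⟩
  rw [← hGe y hy, ← hHe y hy, h3 hy]

theorem Represents.add {e e' e'' : ℝ → EuclideanSpace ℝ (Fin n) → ℝ}
    {G H : C(closure (Ω ×ˢ Ioo (0 : ℝ) T), ℝ)} (hG : Represents G e) (hH : Represents H e')
    (he : ∀ᵐ t, t ∈ Ioo 0 T → ∀ᵐ x, x ∈ Ω → e'' t x = e t x + e' t x) :
    Represents (G + H) e'' := by
  filter_upwards [hG, hH, he] with t h1 h2 h3 ht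
  filter_upwards [h1 ht, h2 ht, h3 ht] with x h4 h5 h6 hx
  rw [ContinuousMap.add_apply, h4 hx, h5 hx, h6 hx]

theorem Represents.smul {c : ℝ} {e e' : ℝ → EuclideanSpace ℝ (Fin n) → ℝ}
    {G : C(closure (Ω ×ˢ Ioo (0 : ℝ) T), ℝ)} (hG : Represents G e)
    (he : ∀ᵐ t, t ∈ Ioo 0 T → ∀ᵐ x, x ∈ Ω → e' t x = c * e t x) : Represents (c • G) e' := by
  filter_upwards [hG, he] with t h1 h3 ht
  filter_upwards [h1 ht, h3 ht] with x h4 h6 hx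
  rw [ContinuousMap.smul_apply, h4 hx, h6 hx, smul_eq_mul]

theorem exists_represents_of_continuousOn (hΩ : IsOpen Ω)
    {G : EuclideanSpace ℝ (Fin n) × ℝ → ℝ} {c : ℝ}
    (hG : ContinuousOn G (closure (Ω ×ˢ Ioo (0 : ℝ) T)))
    (hb : ∀ q ∈ closure (Ω ×ˢ Ioo (0 : ℝ) T), |G q| ≤ c) {e : ℝ → EuclideanSpace ℝ (Fin n) → ℝ}
    (he : ∀ᵐ t ∂(volume.restrict (Ioo 0 T)), ∀ᵐ x ∂(volume.restrict Ω), G (x, t) = e t x) :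
    ∃ H : C(closure (Ω ×ˢ Ioo (0 : ℝ) T), ℝ), Represents H e ∧ ∀ y, |H y| ≤ c := by
  refine ⟨⟨fun y => G y, continuousOn_iff_continuous_domRestrict.1 hG⟩, ?_, fun y => hb y y.2⟩
  rw [ae_restrict_iff' measurableSet_Ioo] at he
  filter_upwards [he] with t ht htT
  have h := ht htT
  rw [ae_restrict_iff' hΩ.measurableSet] at h
  filter_upwards [h] with x hx hxΩ using hx hxΩ

end Represents

theorem IsBoundedLipschitzDomain.exists_represents {n : ℕ}
    {Ω : Set (EuclideanSpace ℝ (Fin n))} (hΩ : IsBoundedLipschitzDomain Ω) {T : ℝ} (hT : 0 < T)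
    {p : ℝ≥0∞} [Fact (1 ≤ p)] (hp : (n : ℝ≥0∞) < p) :
    ∃ C : ℝ, ∀ (u : ℝ → W1p Ω p) (N : ℝ), (∀ᵐ t ∂(volume.restrict (Ioo 0 T)), ‖u t‖ ≤ N) →
      (∃ V : ℝ → LSpace Ω 2, Continuous V ∧ ∀ᵐ t ∂(volume.restrict (Ioo 0 T)),
        W1p.toLSpace (u t) =ᵐ[volume.restrict Ω] V t) →
      ∃ G : C(closure (Ω ×ˢ Ioo (0 : ℝ) T), ℝ),
        Represents G (fun t => W1p.toLSpace (u t)) ∧ ∀ y, |G y| ≤ C * N := by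
  obtain ⟨C, hC⟩ := hΩ.exists_continuous hT hp
  refine ⟨C, fun u N hN ⟨V, hV, hVe⟩ => ?_⟩
  have hcl : closure (Ω ×ˢ Ioo (0 : ℝ) T) = closure Ω ×ˢ Icc 0 T := by
    rw [closure_prod_eq, closure_Ioo hT.ne]
  obtain ⟨G, hG, hGb, hGe⟩ := hC V u N hV (hN.and hVe)
  rw [← hcl] at hG hGb
  exact exists_represents_of_continuousOn hΩ.isOpen hG hGb hGe

theorem H1.exists_continuous {T : ℝ} (hT : 0 < T) {X : Type*} [NormedAddCommGroup X]
    [NormedSpace ℝ X] [CompleteSpace X] (v : H1 T X) :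
    ∃ V : ℝ → X, Continuous V ∧ ∀ᵐ t ∂(volume.restrict (Ioo 0 T)), V t = H1.toBochner v t :=
  IsWeakTimeDerivative.exists_continuous hT ((Lp.memLp v.1.1).integrable (by norm_num))
    ((Lp.memLp v.1.2).integrable (by norm_num)) v.2

namespace LinftyW1pInterH1L2

variable {n : ℕ} {Ω : Set (EuclideanSpace ℝ (Fin n))} {T : ℝ} {p : ℝ≥0∞} [Fact (1 ≤ p)]

theorem fst_fst_add (z z' : LinftyW1pInterH1L2 Ω T p) : (z + z').1.1 = z.1.1 + z'.1.1 := rfl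

theorem fst_fst_smul (c : ℝ) (z : LinftyW1pInterH1L2 Ω T p) : (c • z).1.1 = c • z.1.1 := rfl

theorem agreeAE (z : LinftyW1pInterH1L2 Ω T p) : AgreeAE z.1.1 (H1.toBochner z.1.2) := z.2

theorem ae_norm_le (z : LinftyW1pInterH1L2 Ω T p) :
    ∀ᵐ t ∂(volume.restrict (Ioo 0 T)), ‖z.1.1 t‖ ≤ ‖z‖ := by
  have hle : ‖z.1.1‖ ≤ ‖z‖ :=
    norm_fst_le (z : BochnerSpace T (W1p Ω p) ∞ × H1 T (LSpace Ω 2))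
  filter_upwards [ae_norm_le_norm_of_Linfty z.1.1] with t ht using ht.trans hle

theorem exists_continuous_ae_eq (hT : 0 < T) (z : LinftyW1pInterH1L2 Ω T p) :
    ∃ V : ℝ → LSpace Ω 2, Continuous V ∧ ∀ᵐ t ∂(volume.restrict (Ioo 0 T)),
      W1p.toLSpace (z.1.1 t) =ᵐ[volume.restrict Ω] V t := by
  obtain ⟨V, hV, hVe⟩ := H1.exists_continuous hT z.1.2
  refine ⟨V, hV, ?_⟩
  filter_upwards [agreeAE z, hVe] with t h2 h3
  rw [h3]; exact h2

theorem exists_represents_eval (hΩ : IsBoundedLipschitzDomain Ω) (hT : 0 < T)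
    (hp : (n : ℝ≥0∞) < p) :
    ∃ C : ℝ, ∀ z : LinftyW1pInterH1L2 Ω T p, ∃ G : C(closure (Ω ×ˢ Ioo (0 : ℝ) T), ℝ),
      Represents G (eval z) ∧ ∀ y, |G y| ≤ C * ‖z‖ :=
  (hΩ.exists_represents hT hp).imp fun _ hC z =>
    hC z.1.1 ‖z‖ (ae_norm_le z) (exists_continuous_ae_eq hT z)

theorem eval_add (z z' : LinftyW1pInterH1L2 Ω T p) :
    ∀ᵐ t, t ∈ Ioo 0 T → ∀ᵐ x, x ∈ Ω → eval (z + z') t x = eval z t x + eval z' t x :=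
  ae_toLSpace_add (fst_fst_add z z')

theorem eval_smul (c : ℝ) (z : LinftyW1pInterH1L2 Ω T p) :
    ∀ᵐ t, t ∈ Ioo 0 T → ∀ᵐ x, x ∈ Ω → eval (c • z) t x = c * eval z t x :=
  ae_toLSpace_smul (fst_fst_smul c z)

end LinftyW1pInterH1L2

/-! ### Injectivity and the embedding -/

/-- The weak gradient is determined by the function. -/
theorem W1p.eq_zero_of_toLSpace_eq_zero {n : ℕ} {Ω : Set (EuclideanSpace ℝ (Fin n))}
    (hΩ : IsOpen Ω) {p : ℝ≥0∞} [Fact (1 ≤ p)] {w : W1p Ω p} (hw : W1p.toLSpace w = 0) :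
    w = 0 := by
  have hp : 1 ≤ p := Fact.out
  have hw1 : w.1.1 = 0 := hw
  have h1 : ∀ i, ∀ᵐ x ∂(volume.restrict Ω), w.1.2 x i = 0 := by
    intro i
    rw [ae_restrict_iff' hΩ.measurableSet]
    have hl : LocallyIntegrableOn (fun x => w.1.2 x i) Ω := by
      refine (locallyIntegrableOn_of_locallyIntegrable_restrict
        ((memLp_coord w.1.2 i).locallyIntegrable hp))
    -- The fundamental lemma of the calculus of variations, one component at a time.
    refine hΩ.ae_eq_zero_of_integral_contDiff_smul_eq_zero hl fun φ hφ hφc hφs => ?_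
    have h2 := w.2 φ hφ hφc hφs i
    have h3 : ∫ x in Ω, w.1.1 x * fderiv ℝ φ x (EuclideanSpace.single i 1) = 0 := by
      rw [hw1]
      refine (integral_congr_ae (g := fun _ => (0 : ℝ)) ?_).trans (by simp)
      filter_upwards [Lp.coeFn_zero ℝ p (volume.restrict Ω)] with x hx
      rw [hx, Pi.zero_apply, zero_mul]
    rw [h3, eq_comm, neg_eq_zero] at h2
    rw [← h2, ← setIntegral_eq_integral_of_forall_compl_eq_zero (s := Ω) fun x hx => by
      rw [image_eq_zero_of_notMem_tsupport fun h => hx (hφs h), zero_smul]]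
    simp_rw [smul_eq_mul, mul_comm]
  have h2 : w.1.2 = 0 := by
    rw [Lp.eq_zero_iff_ae_eq_zero]
    filter_upwards [ae_all_iff.2 h1] with x hx
    ext i
    exact hx i
  exact Subtype.ext (Prod.ext hw1 h2)

/-- The weak time derivative is determined by the function. -/
theorem H1.eq_zero_of_toBochner_eq_zero {T : ℝ} {X : Type*} [NormedAddCommGroup X]
    [NormedSpace ℝ X] [CompleteSpace X] {v : H1 T X} (hv : H1.toBochner v = 0) : v = 0 := by
  have hv1 : v.1.1 = 0 := hv
  have h2 : v.1.2 = 0 := by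
    rw [Lp.eq_zero_iff_ae_eq_zero]
    have hl : LocallyIntegrableOn v.1.2 (Ioo 0 T) :=
      IntegrableOn.locallyIntegrableOn ((Lp.memLp v.1.2).integrable (by norm_num))
    refine (ae_restrict_iff' measurableSet_Ioo).2
      (isOpen_Ioo.ae_eq_zero_of_integral_contDiff_smul_eq_zero hl fun φ hφ hφc hφs => ?_)
    have h2 := v.2 φ hφ hφc hφs
    have h3 : ∫ t in Ioo 0 T, deriv φ t • v.1.1 t = 0 := by
      rw [hv1]
      refine (integral_congr_ae (g := fun _ => (0 : X)) ?_).trans (by simp)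
      filter_upwards [Lp.coeFn_zero X 2 (volume.restrict (Ioo 0 T))] with x hx
      rw [hx, Pi.zero_apply, smul_zero]
    rw [h3, eq_comm, neg_eq_zero] at h2
    rw [← h2]
    exact (setIntegral_eq_integral_of_forall_compl_eq_zero fun x hx => by
      rw [image_eq_zero_of_notMem_tsupport fun h => hx (hφs h), zero_smul]).symm
  exact Subtype.ext (Prod.ext hv1 h2)

/-- An element z also carries its weak gradient and time derivative as data, so these have to vanish
along with the function. -/
theorem LinftyW1pInterH1L2.eq_zero_of_represents {n : ℕ} {Ω : Set (EuclideanSpace ℝ (Fin n))}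
    (hΩ : IsOpen Ω) {T : ℝ} {p : ℝ≥0∞} [Fact (1 ≤ p)] {z : LinftyW1pInterH1L2 Ω T p}
    (hz : Represents (0 : C(closure (Ω ×ˢ Ioo (0 : ℝ) T), ℝ)) (LinftyW1pInterH1L2.eval z)) : z = 0 := by
  have h1 : ∀ᵐ t ∂(volume.restrict (Ioo 0 T)), W1p.toLSpace (z.1.1 t) = 0 := by
    rw [ae_restrict_iff' measurableSet_Ioo]
    filter_upwards [hz] with t ht htT
    rw [Lp.eq_zero_iff_ae_eq_zero, EventuallyEq, ae_restrict_iff' hΩ.measurableSet]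
    filter_upwards [ht htT] with x hx hxΩ using (hx hxΩ).symm
  have h2 : z.1.1 = 0 := by
    rw [Lp.eq_zero_iff_ae_eq_zero]
    filter_upwards [h1] with t ht using W1p.eq_zero_of_toLSpace_eq_zero hΩ ht
  have h3 : z.1.2 = 0 := by
    refine H1.eq_zero_of_toBochner_eq_zero ?_
    rw [Lp.eq_zero_iff_ae_eq_zero]
    filter_upwards [h1, LinftyW1pInterH1L2.agreeAE z] with t ht ht'
    rw [Pi.zero_apply, Lp.eq_zero_iff_ae_eq_zero]
    rw [ht] at ht'
    exact ht'.symm.trans (Lp.coeFn_zero ℝ p _)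
  exact Subtype.ext (Prod.ext h2 h3)

theorem theoremA2 {n : ℕ} (hn : 1 ≤ n) (Ω : Set (EuclideanSpace ℝ (Fin n)))
    (hΩ : IsBoundedLipschitzDomain Ω) (T : ℝ) (hT : 0 < T)
    (p : ℝ≥0∞) [Fact (1 ≤ p)] (hp : (n : ℝ≥0∞) < p) :
    ∃ ι : LinftyW1pInterH1L2 Ω T p →ₗ[ℝ] C(closure (Ω ×ˢ Ioo (0 : ℝ) T), ℝ),
      (∀ z : LinftyW1pInterH1L2 Ω T p,
        ∀ᵐ t : ℝ, ∀ ht : t ∈ Ioo 0 T,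
          ∀ᵐ x : EuclideanSpace ℝ (Fin n), ∀ hx : x ∈ Ω,
            ι z ⟨(x, t), subset_closure ⟨hx, ht⟩⟩ = LinftyW1pInterH1L2.eval z t x) ∧
      Function.Injective ι ∧
      ∃ C : ℝ, ∀ (z : LinftyW1pInterH1L2 Ω T p) (y : closure (Ω ×ˢ Ioo (0 : ℝ) T)),
        |ι z y| ≤ C * ‖z‖ := by
  exact exists_injective_linearMap_of_relation
    (fun (z : LinftyW1pInterH1L2 Ω T p) (G : C(closure (Ω ×ˢ Ioo (0 : ℝ) T), ℝ)) =>
      Represents G (LinftyW1pInterH1L2.eval z))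
    (LinftyW1pInterH1L2.exists_represents_eval hΩ hT hp) (fun _ _ _ h h' => h.unique hΩ.isOpen h')
    (fun z z' _ _ h h' => h.add h' (LinftyW1pInterH1L2.eval_add z z'))
    (fun c z _ h => h.smul (LinftyW1pInterH1L2.eval_smul c z))
    (fun _ h => LinftyW1pInterH1L2.eq_zero_of_represents hΩ.isOpen h)
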